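/- **Setting.** Formulas are first-order formulas (without identity) built with $\neg,\wedge,\vee,\forall,\exists$ from individual variables, and denumerably many $n$-ary predicate variables and $n$-ary functional variables for each $n\ge 0$; formulas that differ only in the naming of bound variables are identified. *Semantics.* Given a set $S$ (of "elementary situations"), a state is a subset of $S$, and a bilateral proposition is a pair $\langle X,Y\rangle$ of sets of states with $X\neq Y$ (truthmakers and falsity-makers). An FDEQ model $(D,S,\sigma)$ consists of a non-empty set $D$, a set $S$, and a function $\sigma$ assigning elements of $D$ to individual variables, functions $D^n\to D$ to $n$-ary functional variables, and functions from $D^n$ to bilateral propositions to $n$-ary predicate variables. Truthmakers $\sigma^+$ and falsity-makers $\sigma^-$ of formulas are defined as follows: atomic formulas are evaluated pointwise; $\neg$ exchanges $\sigma^+$ and $\sigma^-$; $\sigma^+(A\wedge B)=\{\Sigma_1\cup\Sigma_2:\Sigma_1\in\sigma^+(A),\Sigma_2\in\sigma^+(B)\}$ and $\sigma^-(A\wedge B)=\sigma^-(A)\cup\sigma^-(B)$; $\sigma^+(\forall xA)$ is the set of unions of selections of one state from $\sigma[a/x]^+(A)$ for each $a\in D$, and $\sigma^-(\forall xA)=\bigcup_{a\in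 D}\sigma[a/x]^-(A)$; $\vee$ and $\exists$ are dual. Sets understood conjunctively (disjunctively) are evaluated like conjunctions (disjunctions). $\varphi\models_{\rm FDEQ}\psi$ means that in every FDEQ model every truthmaker of $\varphi$ includes a truthmaker of $\psi$. For sets $\Gamma,\Delta$ of quantifier-free formulas, $\Gamma\models_{\rm FDE}\Delta$ means: for every set $S$ and every assignment of bilateral propositions over $S$ to the atomic formulas (extended to $\neg,\wedge,\vee$ as above), every truthmaker of $\Gamma$ (a union of a selection of one truthmaker for each element of $\Gamma$) includes a truthmaker of some element of $\Delta$. *Data.* A datum $(E\underline f)(\underline x):\Gamma/\Delta/\cdots$ consists of a finite set $\underline f$ of functional variables, a finite set $\underline x$ of individual variables, and a finite set (the matrix) of finite sets (the components) of formulas; it is evaluated as an existential functional quantification of a universal individual quantification of a disjunction of conjunctions. A dual datum $(\underline f)(E\underline x):\Gamma;\Delta;\cdots$ is evaluated as a universal functional quantification of an existential individual quantification of a conjunction of disjunctions (its components are written with backslashes). Data, and dual data, that differ only in the renaming of bound variables, including those bound by the prefix, are identified. *Calculi.* FDEQDC is the calculus of data with the following rules. The prefix is $(E\underline f)(\underline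 x)$ except where indicated, $\rho$ is the rest of the matrix, and variables displayed in a prefix as added to $\underline f$ or $\underline x$ do not belong to $\underline f$ or $\underline x$. Two-way rules: $\Gamma,A\wedge B/\rho\leftrightarrow\Gamma,A,B/\rho$; $\Gamma,A\vee B/\rho\leftrightarrow\Gamma,A/\Gamma,B/\rho$; $\Gamma,\neg\neg A/\rho\leftrightarrow\Gamma,A/\rho$; $\Gamma,\neg(A\vee B)/\rho\leftrightarrow\Gamma,\neg A,\neg B/\rho$; $\Gamma,\neg(A\wedge B)/\rho\leftrightarrow\Gamma,\neg A/\Gamma,\neg B/\rho$; $(E\underline f)(\underline x):\forall yA,\Gamma/\rho\leftrightarrow(E\underline f)(\underline x,y):A,\Gamma/\rho$, and the same with $\neg\exists yA$ and $\neg A$, provided $y$ is not free in $\Gamma,\rho$; $(E\underline f)(\underline x):\exists yA(y),\Gamma/\rho\leftrightarrow(E\underline f,g)(\underline x):A(g\underline x),\Gamma/\rho$, and the same with $\neg\forall yA(y)$ and $\neg A(g\underline x)$, provided $g$ does not occur in $A(y),\Gamma,\rho$ (here $g\underline x$ applies $g$ to the elements of $\underline x$ listed in some order without repetition). One-way rules: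 from $\Gamma,\Delta/\rho$ to $\Gamma/\rho$; from $\rho$ to $\Gamma/\rho$; from $(E\underline f)(\underline x,y):\alpha(y)$ to $(E\underline f)(\underline x):\alpha(t)$, for any term $t$; from $(E\underline f)(\underline x):\alpha(t)$ to $(E\underline f,g)(\underline x):\alpha(g\underline x)$, for any term $t$, provided $g$ is not in $\alpha(y)$; from $(E\underline f,g)(\underline x):\alpha$ to $(E\underline f)(\underline x):\alpha$, provided $g$ is not in $\alpha$; from $(E\underline f)(\underline x):\alpha$ to $(E\underline f)(\underline x,y):\alpha$, provided $y$ is not free in $\alpha$. FDEQDDC is the calculus of dual data whose rules are the duals of these ($\wedge$ exchanged with $\vee$, $\forall$ with $\exists$, data with dual data, premiss with conclusion). Strict Criss-Crossing allows one to infer $(\underline g)(E\underline y):\delta$ from $(E\underline f)(\underline x):\alpha$, where $\underline f$ do not occur in $\delta$ nor $\underline g$ in $\alpha$, if there are results $\alpha_0,\delta_0$ of substituting arbitrary terms for $\underline x$ in $\alpha$ and for $\underline y$ in $\delta$, respectively, such that every component of $\alpha_0$ has a formula in common with every component of $\delta_0$. A deduction in FDEQHC of a dual datum from a datum consists of an FDEQDC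 deduction, one application of strict Criss-Crossing, and an FDEQDDC deduction. **Theorem.** (1) (Herbrand theorem for FDEQ) Let $A$ and $B$ be quantifier-free, and let $F$ be the set of functional variables occurring in $A$ or in $B$. Let $\Gamma$ and $\Delta$ be the sets of all formulas obtained from $A$ and from $B$, respectively, by uniformly substituting terms built from arbitrary individual variables and the functional variables in $F$ for $\underline x$ in $A$ and for $\underline y$ in $B$. Then $\forall\underline x\,A\models_{\rm FDEQ}\exists\underline y\,B$ if and only if $\Gamma\models_{\rm FDE}\Delta$. (2) (Deductive completeness of FDEQHC) For every datum $\alpha$ and every dual datum $\delta$: if $\alpha\models_{\rm FDEQ}\delta$, then $\delta$ is deducible from $\alpha$ in FDEQHC. -/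

import Mathlib

universe u v

namespace FDEQ

/-! ### The language

First-order formulas with predicate variables and functional variables of every arity and without
identity, over the logical constants `¬, ∧, ∨, ∀, ∃`.  Individual variables are the names
`fvar 0, fvar 1, …`.  Variables bound by a quantifier inside a formula are nameless (`bvar i`), so
that formulas which differ only in the naming of bound variables are the same object, and
substitution cannot capture.  An element of `Formula n` may contain `n` unbound nameless
variables (place-holders); ordinary formulas are the elements of `Formula 0`. -/

/-- A functional variable: its arity and its index. -/
abbrev FunVar := ℕ × ℕ

/-- Terms; `app k f ts` applies the `k`-ary functional variable with index `f`. -/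
inductive Term (n : ℕ) : Type
  | bvar (i : Fin n) : Term n
  | fvar (x : ℕ) : Term n
  | app (k f : ℕ) (ts : Fin k → Term n) : Term n

namespace Term

/-- Simultaneous substitution for the nameless variables (`s`) and the individual variables (`τ`). -/
def subst {n m : ℕ} (s : Fin n → Term m) (τ : ℕ → Term m) : Term n → Term m
  | bvar i => s i
  | fvar x => τ x
  | app k f ts => app k f (fun i => (ts i).subst s τ)

/-- A term regarded in a context with one more (last) nameless variable. -/
def lift {n : ℕ} (t : Term n) : Term (n + 1) :=
  t.subst (fun i => bvar i.castSucc) fvar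

/-- Renaming of functional variables (`e`) and of individual variables (`p`). -/
def rename {n : ℕ} (e : ℕ → Equiv.Perm ℕ) (p : Equiv.Perm ℕ) : Term n → Term n
  | bvar i => bvar i
  | fvar x => fvar (p x)
  | app k f ts => app k (e k f) (fun i => (ts i).rename e p)

/-- The functional variables occurring in a term. -/
def funs {n : ℕ} : Term n → Finset FunVar
  | bvar _ => ∅
  | fvar _ => ∅
  | app k f ts => insert (k, f) (Finset.univ.biUnion fun i => (ts i).funs)

/-- The individual variables occurring in a term. -/
def vars {n : ℕ} : Term n → Finset ℕ
  | bvar _ => ∅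
  | fvar x => {x}
  | app _ _ ts => Finset.univ.biUnion fun i => (ts i).vars

end Term

/-- Formulas; `rel k R ts` applies the `k`-ary predicate variable with index `R`.  In `all A` and
`ex A` the quantifier binds the last nameless variable of `A`. -/
inductive Formula : ℕ → Type
  | rel {n : ℕ} (k R : ℕ) (ts : Fin k → Term n) : Formula n
  | neg {n : ℕ} (A : Formula n) : Formula n
  | and {n : ℕ} (A B : Formula n) : Formula n
  | or {n : ℕ} (A B : Formula n) : Formula n
  | all {n : ℕ} (A : Formula (n + 1)) : Formula n
  | ex {n : ℕ} (A : Formula (n + 1)) : Formula n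

noncomputable instance {n : ℕ} : DecidableEq (Formula n) := Classical.decEq _

namespace Formula

/-- Simultaneous substitution for the nameless variables (`s`) and the individual variables (`τ`). -/
def subst : {n m : ℕ} → (Fin n → Term m) → (ℕ → Term m) → Formula n → Formula m
  | _, _, s, τ, rel k R ts => rel k R (fun i => (ts i).subst s τ)
  | _, _, s, τ, neg A => neg (A.subst s τ)
  | _, _, s, τ, and A B => and (A.subst s τ) (B.subst s τ)
  | _, _, s, τ, or A B => or (A.subst s τ) (B.subst s τ)
  | _, m, s, τ, all A =>
      all (A.subst (Fin.snoc (α := fun _ => Term (m + 1)) (fun i => (s i).lift)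
        (Term.bvar (Fin.last m))) (fun x => (τ x).lift))
  | _, m, s, τ, ex A =>
      ex (A.subst (Fin.snoc (α := fun _ => Term (m + 1)) (fun i => (s i).lift)
        (Term.bvar (Fin.last m))) (fun x => (τ x).lift))

/-- `A(t₀, …, tₙ₋₁)`: the terms `t i` are put for the `n` place-holders of `A`. -/
def inst {n : ℕ} (A : Formula n) (t : Fin n → Term 0) : Formula 0 :=
  A.subst t Term.fvar

/-- `A(t)`, for a formula `A` with one place-holder. -/
def inst₁ (A : Formula 1) (t : Term 0) : Formula 0 :=
  A.inst (fun _ => t)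

/-- Substitution of terms for the (free) individual variables. -/
def substVars (τ : ℕ → Term 0) (A : Formula 0) : Formula 0 :=
  A.subst Term.bvar τ

/-- Renaming of functional variables (`e`) and of free individual variables (`p`). -/
def rename (e : ℕ → Equiv.Perm ℕ) (p : Equiv.Perm ℕ) : {n : ℕ} → Formula n → Formula n
  | _, rel k R ts => rel k R (fun i => (ts i).rename e p)
  | _, neg A => neg (A.rename e p)
  | _, and A B => and (A.rename e p) (B.rename e p)
  | _, or A B => or (A.rename e p) (B.rename e p)
  | _, all A => all (A.rename e p)
  | _, ex A => ex (A.rename e p)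

/-- The functional variables occurring in a formula. -/
def funs : {n : ℕ} → Formula n → Finset FunVar
  | _, rel _ _ ts => Finset.univ.biUnion fun i => (ts i).funs
  | _, neg A => A.funs
  | _, and A B => A.funs ∪ B.funs
  | _, or A B => A.funs ∪ B.funs
  | _, all A => A.funs
  | _, ex A => A.funs

/-- The individual variables occurring free in a formula. -/
def vars : {n : ℕ} → Formula n → Finset ℕ
  | _, rel _ _ ts => Finset.univ.biUnion fun i => (ts i).vars
  | _, neg A => A.vars
  | _, and A B => A.vars ∪ B.vars
  | _, or A B => A.vars ∪ B.vars
  | _, all A => A.vars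
  | _, ex A => A.vars

/-- Quantifier-free formulas. -/
def QuantifierFree : {n : ℕ} → Formula n → Prop
  | _, rel _ _ _ => True
  | _, neg A => A.QuantifierFree
  | _, and A B => A.QuantifierFree ∧ B.QuantifierFree
  | _, or A B => A.QuantifierFree ∧ B.QuantifierFree
  | _, all _ => False
  | _, ex _ => False

/-- The dual of a formula: `∧` and `∨` are exchanged, and so are `∀` and `∃`. -/
def dual : {n : ℕ} → Formula n → Formula n
  | _, rel k R ts => rel k R ts
  | _, neg A => neg A.dual
  | _, and A B => or A.dual B.dual
  | _, or A B => and A.dual B.dual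
  | _, all A => ex A.dual
  | _, ex A => all A.dual

/-- `∀x₁ … ∀xₙ A`, where `x₁, …, xₙ` are the place-holders of `A`. -/
def allClosure : {n : ℕ} → Formula n → Formula 0
  | 0, A => A
  | _ + 1, A => allClosure (all A)

/-- `∃x₁ … ∃xₙ A`, where `x₁, …, xₙ` are the place-holders of `A`. -/
def exClosure : {n : ℕ} → Formula n → Formula 0
  | 0, A => A
  | _ + 1, A => exClosure (ex A)

end Formula

/-- The Herbrand universe for a set `F` of functional variables: the terms built from arbitrary
individual variables and the functional variables in `F`. -/
def herbrandUniverse (F : Finset FunVar) : Set (Term 0) :=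
  {t | t.funs ⊆ F}

/-- The Herbrand instances, w.r.t. `F`, of `∀x₁ … ∀xₙ A` or `∃x₁ … ∃xₙ A`. -/
def herbrandInstances (F : Finset FunVar) {n : ℕ} (A : Formula n) : Set (Formula 0) :=
  {C | ∃ t : Fin n → Term 0, (∀ i, t i ∈ herbrandUniverse F) ∧ C = A.inst t}

/-! ### Truthmaker semantics

An elementary situation space is any type `S`; a state is a set of elementary situations. -/

/-- Bilateral propositions: pairs `(X, Y)` of distinct sets of states (the truthmakers and the
falsity-makers). -/
def Bilateral (S : Type v) : Type v :=
  {p : Set (Set S) × Set (Set S) // p.1 ≠ p.2}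

/-- The states that fuse (unite) a selection of one state from `X i` for each index `i ∈ I`. -/
def fusions {ι : Type*} {S : Type v} (I : Set ι) (X : ι → Set (Set S)) : Set (Set S) :=
  {s | ∃ c : ι → Set S, (∀ i ∈ I, c i ∈ X i) ∧ s = ⋃ i ∈ I, c i}

/-- The states that fuse a state from `X` with a state from `Y`. -/
def fusions₂ {S : Type v} (X Y : Set (Set S)) : Set (Set S) :=
  {s | ∃ a ∈ X, ∃ b ∈ Y, s = a ∪ b}

/-- An FDEQ model with domain of individuals `D` and elementary situation space `S`.  (`D` is
non-empty, since it contains the values of the individual variables.) -/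
structure Model (D : Type u) (S : Type v) where
  /-- values of the individual variables -/
  var : ℕ → D
  /-- values of the functional variables, by arity and index -/
  func : (k : ℕ) → ℕ → (Fin k → D) → D
  /-- values of the predicate variables, by arity and index: bilateral propositional functions -/
  pred : (k : ℕ) → ℕ → (Fin k → D) → Bilateral S

/-- The value of a term; `a` interprets the nameless variables. -/
def Term.eval {D : Type u} {S : Type v} (M : Model D S) {n : ℕ} (a : Fin n → D) : Term n → D
  | .bvar i => a i
  | .fvar x => M.var x
  | .app k f ts => M.func k f (fun i => (ts i).eval M a)

/-- The pair (truthmakers, falsity-makers) of a formula in an FDEQ model; `a` interprets the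
nameless variables. -/
def Formula.eval {D : Type u} {S : Type v} (M : Model D S) :
    {n : ℕ} → (Fin n → D) → Formula n → Set (Set S) × Set (Set S)
  | _, a, .rel k R ts => (M.pred k R (fun i => (ts i).eval M a)).1
  | _, a, .neg A => ((A.eval M a).2, (A.eval M a).1)
  | _, a, .and A B =>
      (fusions₂ (A.eval M a).1 (B.eval M a).1, (A.eval M a).2 ∪ (B.eval M a).2)
  | _, a, .or A B =>
      ((A.eval M a).1 ∪ (B.eval M a).1, fusions₂ (A.eval M a).2 (B.eval M a).2)
  | _, a, .all A =>
      (fusions Set.univ (fun d : D => (A.eval M (Fin.snoc (α := fun _ => D) a d)).1),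
        ⋃ d : D, (A.eval M (Fin.snoc (α := fun _ => D) a d)).2)
  | _, a, .ex A =>
      (⋃ d : D, (A.eval M (Fin.snoc (α := fun _ => D) a d)).1,
        fusions Set.univ (fun d : D => (A.eval M (Fin.snoc (α := fun _ => D) a d)).2))

/-- The truthmakers of a formula in an FDEQ model. -/
def Formula.truthmakers {D : Type u} {S : Type v} (M : Model D S) (A : Formula 0) : Set (Set S) :=
  (A.eval M Fin.elim0).1

/-- FDEQ consequence between formulas. -/
def FormulaEntails (A B : Formula 0) : Prop :=
  ∀ (D : Type u) (S : Type v) (M : Model D S),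
    ∀ s ∈ A.truthmakers M, ∃ s' ∈ B.truthmakers M, s' ⊆ s

/-- An FDE model for the quantifier-free formulas assigns bilateral propositions to the atomic
formulas; this is the pair (truthmakers, falsity-makers) to which it extends.  (Only used for
quantifier-free formulas; the clauses for quantifications are dummies.) -/
def Formula.propEval {S : Type v} : {n : ℕ} → ((k R : ℕ) → (Fin k → Term n) → Bilateral S) →
    Formula n → Set (Set S) × Set (Set S)
  | _, σ, .rel k R ts => (σ k R ts).1
  | _, σ, .neg A => ((A.propEval σ).2, (A.propEval σ).1)
  | _, σ, .and A B =>
      (fusions₂ (A.propEval σ).1 (B.propEval σ).1, (A.propEval σ).2 ∪ (B.propEval σ).2)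
  | _, σ, .or A B =>
      ((A.propEval σ).1 ∪ (B.propEval σ).1, fusions₂ (A.propEval σ).2 (B.propEval σ).2)
  | _, _, .all _ => (∅, ∅)
  | _, _, .ex _ => (∅, ∅)

/-- FDE consequence `Γ ⊨ Δ` for sets of quantifier-free formulas, `Γ` understood conjunctively and
`Δ` disjunctively: in every FDE model, every truthmaker of `Γ` (fusion of a selection of one
truthmaker for each element of `Γ`) includes a truthmaker of some element of `Δ`. -/
def FDEEntails (Γ Δ : Set (Formula 0)) : Prop :=
  ∀ (S : Type v) (σ : (k R : ℕ) → (Fin k → Term 0) → Bilateral S),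
    ∀ s ∈ fusions Γ (fun A => (A.propEval σ).1), ∃ B ∈ Δ, ∃ s' ∈ (B.propEval σ).1, s' ⊆ s

/-! ### Data and dual data -/

/-- Matrices of data and of dual data: finite sets of finite sets of formulas. -/
abbrev DatumMatrix := Finset (Finset (Formula 0))

namespace DatumMatrix

/-- The functional variables occurring in a matrix. -/
def funs (α : DatumMatrix) : Finset FunVar := α.biUnion fun Γ => Γ.biUnion Formula.funs

/-- The individual variables occurring free in a matrix. -/
def vars (α : DatumMatrix) : Finset ℕ := α.biUnion fun Γ => Γ.biUnion Formula.vars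

/-- Application of an operation to all formulas of a matrix. -/
noncomputable def map (h : Formula 0 → Formula 0) (α : DatumMatrix) : DatumMatrix :=
  Finset.image (fun Γ => Finset.image h Γ) α

/-- `α(t)`, the result of putting the term `t` for the variable `y` in `α = α(y)`. -/
noncomputable def substVar (α : DatumMatrix) (y : ℕ) (t : Term 0) : DatumMatrix :=
  map (Formula.substVars (Function.update Term.fvar y t)) α

/-- `α₀` results from `α` by uniform substitution of arbitrary terms for the variables in `X`. -/
def IsInstance (X : Finset ℕ) (α α₀ : DatumMatrix) : Prop :=
  ∃ τ : ℕ → Term 0, (∀ x ∉ X, τ x = Term.fvar x) ∧ α₀ = map (Formula.substVars τ) α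

end DatumMatrix

/-- A datum `(E f̲)(x̲): Γ / Δ / …`, with existential functional prefix `funs` and universal
individual prefix `vars`; the matrix is a disjunction of conjunctions.  Data that differ only in the
naming of the variables bound by the prefix count as identical: see `Datum.SameUpToRenaming`. -/
structure Datum where
  funs : Finset FunVar
  vars : Finset ℕ
  matrix : DatumMatrix

/-- A dual datum `(f̲)(E x̲): Γ ; Δ ; …`, with universal functional prefix `funs` and existential
individual prefix `vars`; the matrix is a conjunction of disjunctions. -/
structure DualDatum where
  funs : Finset FunVar
  vars : Finset ℕ
  matrix : DatumMatrix

/-- `N` agrees with `M` except perhaps on the functional variables in `F`. -/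
def Model.IsFunVariant {D : Type u} {S : Type v} (F : Finset FunVar) (M N : Model D S) : Prop :=
  N.var = M.var ∧ N.pred = M.pred ∧ ∀ k f, (k, f) ∉ F → N.func k f = M.func k f

/-- `N` agrees with `M` except perhaps on the individual variables in `X`. -/
def Model.IsVarVariant {D : Type u} {S : Type v} (X : Finset ℕ) (M N : Model D S) : Prop :=
  N.func = M.func ∧ N.pred = M.pred ∧ ∀ x ∉ X, N.var x = M.var x

/-- The truthmakers of a datum.  The prefixes are treated like quantifiers, slashes like `∨` and
commas like `∧`. -/
def Datum.truthmakers {D : Type u} {S : Type v} (M : Model D S) (α : Datum) : Set (Set S) :=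
  ⋃ N ∈ {N | M.IsFunVariant α.funs N},
    fusions {P | N.IsVarVariant α.vars P} fun P =>
      ⋃ Γ ∈ α.matrix, fusions (Γ : Set (Formula 0)) (Formula.truthmakers P)

/-- The truthmakers of a dual datum.  The prefixes are treated like quantifiers, semicolons like
`∧` and backslashes like `∨`. -/
def DualDatum.truthmakers {D : Type u} {S : Type v} (M : Model D S) (δ : DualDatum) :
    Set (Set S) :=
  fusions {N | M.IsFunVariant δ.funs N} fun N =>
    ⋃ P ∈ {P | N.IsVarVariant δ.vars P},
      fusions (δ.matrix : Set (Finset (Formula 0))) fun Γ => ⋃ A ∈ Γ, Formula.truthmakers P A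

/-- FDEQ consequence between a datum and a dual datum. -/
def Entails (α : Datum) (δ : DualDatum) : Prop :=
  ∀ (D : Type u) (S : Type v) (M : Model D S),
    ∀ s ∈ α.truthmakers M, ∃ s' ∈ δ.truthmakers M, s' ⊆ s

/-! ### The calculi -/

/-- The data `α` and `β` differ only in the renaming of variables bound by the prefix. -/
def Datum.SameUpToRenaming (α β : Datum) : Prop :=
  ∃ (e : ℕ → Equiv.Perm ℕ) (p : Equiv.Perm ℕ),
    (∀ g ∈ α.matrix.funs, g ∉ α.funs → e g.1 g.2 = g.2) ∧
    (∀ x ∈ α.matrix.vars, x ∉ α.vars → p x = x) ∧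
    β.funs = α.funs.image (fun g => (g.1, e g.1 g.2)) ∧
    β.vars = α.vars.image p ∧
    β.matrix = α.matrix.map (Formula.rename e p)

/-- `t` is a term `g(x₁, …, xₖ)` where `x₁, …, xₖ` lists the elements of `X` without repetition. -/
def IsSkolemTerm (g : FunVar) (X : Finset ℕ) (t : Term 0) : Prop :=
  ∃ x : Fin g.1 → ℕ, Function.Injective x ∧ Finset.univ.image x = X ∧
    t = Term.app g.1 g.2 (fun i => Term.fvar (x i))

/-- The grounding rules for data.  `GRule α β`: the datum `α` stands at the top, and `β` at the
bottom, of a two-way rule.  A component `Γ, A` is `insert A Γ`, and `ρ` is the rest of the datum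
(`Γ` may contain `A`, and `ρ` may contain the displayed components). -/
inductive GRule : Datum → Datum → Prop
  | and (F X) (A B : Formula 0) (Γ : Finset (Formula 0)) (ρ : DatumMatrix) :
      GRule ⟨F, X, insert (insert (A.and B) Γ) ρ⟩ ⟨F, X, insert (insert A (insert B Γ)) ρ⟩
  | or (F X) (A B : Formula 0) (Γ : Finset (Formula 0)) (ρ : DatumMatrix) :
      GRule ⟨F, X, insert (insert (A.or B) Γ) ρ⟩ ⟨F, X, insert (insert A Γ) (insert (insert B Γ) ρ)⟩
  | negNeg (F X) (A : Formula 0) (Γ : Finset (Formula 0)) (ρ : DatumMatrix) :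
      GRule ⟨F, X, insert (insert A.neg.neg Γ) ρ⟩ ⟨F, X, insert (insert A Γ) ρ⟩
  | negOr (F X) (A B : Formula 0) (Γ : Finset (Formula 0)) (ρ : DatumMatrix) :
      GRule ⟨F, X, insert (insert (A.or B).neg Γ) ρ⟩
        ⟨F, X, insert (insert A.neg (insert B.neg Γ)) ρ⟩
  | negAnd (F X) (A B : Formula 0) (Γ : Finset (Formula 0)) (ρ : DatumMatrix) :
      GRule ⟨F, X, insert (insert (A.and B).neg Γ) ρ⟩
        ⟨F, X, insert (insert A.neg Γ) (insert (insert B.neg Γ) ρ)⟩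
  | all (F X) (y : ℕ) (A : Formula 1) (Γ : Finset (Formula 0)) (ρ : DatumMatrix) :
      y ∉ X → y ∉ A.vars → y ∉ Γ.biUnion Formula.vars → y ∉ ρ.vars →
      GRule ⟨F, X, insert (insert A.all Γ) ρ⟩
        ⟨F, insert y X, insert (insert (A.inst₁ (Term.fvar y)) Γ) ρ⟩
  | negEx (F X) (y : ℕ) (A : Formula 1) (Γ : Finset (Formula 0)) (ρ : DatumMatrix) :
      y ∉ X → y ∉ A.vars → y ∉ Γ.biUnion Formula.vars → y ∉ ρ.vars →
      GRule ⟨F, X, insert (insert A.ex.neg Γ) ρ⟩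
        ⟨F, insert y X, insert (insert (A.inst₁ (Term.fvar y)).neg Γ) ρ⟩
  | ex (F X) (g : FunVar) (t : Term 0) (A : Formula 1) (Γ : Finset (Formula 0)) (ρ : DatumMatrix) :
      IsSkolemTerm g X t →
      g ∉ F → g ∉ A.funs → g ∉ Γ.biUnion Formula.funs → g ∉ ρ.funs →
      GRule ⟨F, X, insert (insert A.ex Γ) ρ⟩
        ⟨insert g F, X, insert (insert (A.inst₁ t) Γ) ρ⟩
  | negAll (F X) (g : FunVar) (t : Term 0) (A : Formula 1) (Γ : Finset (Formula 0)) (ρ : DatumMatrix) :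
      IsSkolemTerm g X t →
      g ∉ F → g ∉ A.funs → g ∉ Γ.biUnion Formula.funs → g ∉ ρ.funs →
      GRule ⟨F, X, insert (insert A.all.neg Γ) ρ⟩
        ⟨insert g F, X, insert (insert (A.inst₁ t).neg Γ) ρ⟩

/-- The structural rules for data.  `SRule α β`: from `α` infer `β`. -/
inductive SRule : Datum → Datum → Prop
  /-- Deletion -/
  | del (F X) (Γ Δ : Finset (Formula 0)) (ρ : DatumMatrix) :
      SRule ⟨F, X, insert (Γ ∪ Δ) ρ⟩ ⟨F, X, insert Γ ρ⟩
  /-- Expansion -/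
  | exp (F X) (Γ : Finset (Formula 0)) (ρ : DatumMatrix) :
      SRule ⟨F, X, ρ⟩ ⟨F, X, insert Γ ρ⟩
  /-- Instantiation: from `(E f̲)(x̲, y): α(y)` to `(E f̲)(x̲): α(t)` -/
  | inst (F X) (y : ℕ) (t : Term 0) (α : DatumMatrix) :
      y ∉ X → SRule ⟨F, insert y X, α⟩ ⟨F, X, α.substVar y t⟩
  /-- Generalization: from `(E f̲)(x̲): α(t)` to `(E f̲, g)(x̲): α(g x̲)` -/
  | gen (F X) (g : FunVar) (y : ℕ) (t t' : Term 0) (α : DatumMatrix) :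
      IsSkolemTerm g X t' → g ∉ F → g ∉ α.funs →
      SRule ⟨F, X, α.substVar y t⟩ ⟨insert g F, X, α.substVar y t'⟩
  /-- Elimination of vacuous existential variables -/
  | eve (F X) (g : FunVar) (α : DatumMatrix) :
      g ∉ F → g ∉ α.funs → SRule ⟨insert g F, X, α⟩ ⟨F, X, α⟩
  /-- Introduction of vacuous universal variables -/
  | ivu (F X) (y : ℕ) (α : DatumMatrix) :
      y ∉ X → y ∉ α.vars → SRule ⟨F, X, α⟩ ⟨F, insert y X, α⟩

/-- One step of a deduction in FDEQDC: a G-rule applied in either direction, an S-rule, or a passage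
to another expression for the same datum. -/
def DCStep (α β : Datum) : Prop :=
  GRule α β ∨ GRule β α ∨ SRule α β ∨ α.SameUpToRenaming β

/-- Deducibility of data from data in FDEQDC. -/
def DCDeducible (α β : Datum) : Prop := Relation.ReflTransGen DCStep α β

/-- The datum dual to a dual datum: the formulas are dualized, backslashes become commas and
semicolons slashes, and the prefix `(f̲)(E x̲)` becomes `(E f̲)(x̲)`. -/
noncomputable def DualDatum.dual (δ : DualDatum) : Datum :=
  ⟨δ.funs, δ.vars, δ.matrix.map Formula.dual⟩

/-- One step of a deduction in FDEQDDC, whose rules are the duals of those of FDEQDC: dualization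
reverses the direction of inference and dualizes premiss and conclusion.  So, besides the two-way
G-rules, one has Expansion (from `Γ ; ρ` to `Γ \ Δ ; ρ`), Deletion (from `Γ ; ρ` to `ρ`),
Generalization (from `(f̲)(E x̲): δ(t)` to `(f̲)(E x̲, y): δ(y)`), Instantiation (from
`(f̲, g)(E x̲): δ(g x̲)` to `(f̲)(E x̲): δ(t)`), introduction of vacuous universal functional
variables and elimination of vacuous existential individual variables. -/
def DDCStep (δ ε : DualDatum) : Prop := DCStep ε.dual δ.dual

/-- Deducibility of dual data from dual data in FDEQDDC. -/
def DDCDeducible (δ ε : DualDatum) : Prop := Relation.ReflTransGen DDCStep δ ε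

/-- The (strict) Criss-Crossing rule: from `(E f̲)(x̲): α` infer `(g̲)(E y̲): δ` if there are
instances `α₀` of `(x̲): α` and `δ₀` of `(E y̲): δ` such that every component of `α₀` has a formula
in common with every component of `δ₀`.  As the `f̲` are bound in the premiss and the `g̲` in the
conclusion, the `f̲` must not occur in `δ`, nor the `g̲` in `α`. -/
def CrissCross (α : Datum) (δ : DualDatum) : Prop :=
  Disjoint α.funs δ.matrix.funs ∧ Disjoint δ.funs α.matrix.funs ∧
  ∃ α₀ δ₀ : DatumMatrix, DatumMatrix.IsInstance α.vars α.matrix α₀ ∧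
    DatumMatrix.IsInstance δ.vars δ.matrix δ₀ ∧
    ∀ Γ ∈ α₀, ∀ Δ ∈ δ₀, ∃ A, A ∈ Γ ∧ A ∈ Δ

/-- Deducibility of a dual datum from a datum in FDEQHC: an FDEQDC deduction, one application of
Criss-Crossing, and an FDEQDDC deduction. -/
def HCDeducible (α : Datum) (δ : DualDatum) : Prop :=
  ∃ (β : Datum) (ε : DualDatum), DCDeducible α β ∧ CrissCross β ε ∧ DDCDeducible ε δ

end FDEQ

/-! Fix a state `s` and record, for each formula, whether it has a truthmaker included in `s` and
whether it has a falsity-maker included in `s`. A union of states lies in `s` exactly when all of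
them do, so fusion acts as conjunction and union of sets of states as disjunction: the record is
ordinary evaluation in a four-valued structure, where truth and falsity of atoms are independent
(`Formula.supports_eval`). Conversely, every such structure arises with `s = ∅` from a model over a
single elementary situation (`Interp.exists_model`).

Herbrand theorem: a propositional countermodel is read as a structure on the set of all terms, atoms
being looked up after retracting terms to the Herbrand universe; in the other direction an FDEQ
model assigns propositions to atoms through the values of their terms. The sets of instances may be
infinite, so no compactness is needed.

Completeness: dualizing formulas and complementing extensions and anti-extensions exchanges truth
and untruth (`Formula.holds_dual_compl`), so an entailment from `α` to `δ` prevents the data `α` and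
`δ.dual` from holding in a structure and in its complement, respectively (`Entails.not_sat`).
Grounding rules reduce both data to literals (`exists_literal_datum`), and their functional prefixes
are renamed apart. If no finitely many instances of the two matrices forced an overlap of
components, Rado selection would pick a component of every instance so that no literal is picked on
both sides; making true exactly the literals picked on the first side gives a forbidden term
structure (`exists_finite_instances`).

Criss-Crossing, however, admits one instance on each side. `exists_multiplication` bridges the gap
inside FDEQDC: the matrix is folded into one formula and closed universally, the closure is
instantiated with fresh variables as often as needed, and the result is multiplied out. One instance
of the new matrix then does the work of all the required instances. The FDEQDDC half is the mirror
image of a deduction from `δ.dual`. -/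

namespace FDEQ

/-! ### Substitution -/

theorem Term.subst_subst {n m l : ℕ} (s : Fin n → Term m) (τ : ℕ → Term m)
    (s' : Fin m → Term l) (τ' : ℕ → Term l) (t : Term n) :
    (t.subst s τ).subst s' τ' =
      t.subst (fun i => (s i).subst s' τ') (fun x => (τ x).subst s' τ') := by
  induction t with
  | bvar i => rfl
  | fvar x => rfl
  | app k f ts ih => simp only [Term.subst, ih]

theorem Term.subst_id {n : ℕ} (t : Term n) : t.subst Term.bvar Term.fvar = t := by
  induction t with
  | bvar i => rfl
  | fvar x => rfl
  | app k f ts ih => simp only [Term.subst, ih]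

/-- The substitution for nameless variables under a quantifier. -/
def liftSubst {n m : ℕ} (s : Fin n → Term m) : Fin (n + 1) → Term (m + 1) :=
  Fin.snoc (α := fun _ => Term (m + 1)) (fun i => (s i).lift) (Term.bvar (Fin.last m))

theorem Term.lift_subst_liftSubst {m l : ℕ} (s : Fin m → Term l) (τ : ℕ → Term l) (t : Term m) :
    t.lift.subst (liftSubst s) (fun x => (τ x).lift) = (t.subst s τ).lift := by
  simp only [Term.lift, Term.subst_subst]
  congr 1
  funext i
  simp [Term.subst, liftSubst, Term.lift]

theorem liftSubst_comp {n m l : ℕ} (s : Fin n → Term m) (s' : Fin m → Term l) (τ' : ℕ → Term l) :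
    (fun i => (liftSubst s i).subst (liftSubst s') (fun x => (τ' x).lift)) =
      liftSubst (fun i => (s i).subst s' τ') := by
  funext i
  refine Fin.lastCases ?_ (fun i => ?_) i
  · simp [liftSubst, Term.subst]
  · have := Term.lift_subst_liftSubst s' τ' (s i)
    simpa [liftSubst] using this

theorem liftSubst_bvar {n : ℕ} : liftSubst (Term.bvar : Fin n → Term n) = Term.bvar := by
  funext i
  refine Fin.lastCases ?_ (fun i => ?_) i <;> simp [liftSubst, Term.lift, Term.subst]

theorem Formula.subst_subst {n m l : ℕ} (s : Fin n → Term m) (τ : ℕ → Term m)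
    (s' : Fin m → Term l) (τ' : ℕ → Term l) (A : Formula n) :
    (A.subst s τ).subst s' τ' =
      A.subst (fun i => (s i).subst s' τ') (fun x => (τ x).subst s' τ') := by
  induction A generalizing m l with
  | rel k R ts => simp only [Formula.subst, Term.subst_subst]
  | neg A ih => simp only [Formula.subst, ih]
  | and A B ih₁ ih₂ => simp only [Formula.subst, ih₁, ih₂]
  | or A B ih₁ ih₂ => simp only [Formula.subst, ih₁, ih₂]
  | all A ih =>
    simp only [Formula.subst, ih]
    congr 2
    · exact liftSubst_comp s s' τ'
    · funext x; exact Term.lift_subst_liftSubst s' τ' (τ x)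
  | ex A ih =>
    simp only [Formula.subst, ih]
    congr 2
    · exact liftSubst_comp s s' τ'
    · funext x; exact Term.lift_subst_liftSubst s' τ' (τ x)

theorem Formula.subst_id {n : ℕ} (A : Formula n) : A.subst Term.bvar Term.fvar = A := by
  induction A with
  | rel k R ts => simp only [Formula.subst, Term.subst_id]
  | neg A ih => simp only [Formula.subst, ih]
  | and A B ih₁ ih₂ => simp only [Formula.subst, ih₁, ih₂]
  | or A B ih₁ ih₂ => simp only [Formula.subst, ih₁, ih₂]
  | all A ih => exact congrArg Formula.all (by rw [← liftSubst, liftSubst_bvar]; exact ih)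
  | ex A ih => exact congrArg Formula.ex (by rw [← liftSubst, liftSubst_bvar]; exact ih)

theorem Formula.substVars_fvar (A : Formula 0) : A.substVars Term.fvar = A := A.subst_id

theorem Formula.substVars_substVars (σ τ : ℕ → Term 0) (A : Formula 0) :
    (A.substVars σ).substVars τ = A.substVars fun x => (σ x).subst Term.bvar τ := by
  rw [Formula.substVars, Formula.substVars, Formula.subst_subst]; rfl

/-! ### Individual and functional variables occurring after a substitution. -/

theorem Term.vars_subst {n m : ℕ} {s : Fin n → Term m} {τ : ℕ → Term m} {t : Term n} {z : ℕ}
    (h : z ∈ (t.subst s τ).vars) : (∃ i, z ∈ (s i).vars) ∨ ∃ x ∈ t.vars, z ∈ (τ x).vars := by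
  induction t with
  | bvar i => exact .inl ⟨i, h⟩
  | fvar x => exact .inr ⟨x, by simp [Term.vars], h⟩
  | app k f ts ih =>
    simp only [Term.subst, Term.vars, Finset.mem_biUnion] at h ⊢
    obtain ⟨i, -, hi⟩ := h
    rcases ih i hi with h | ⟨x, hx, h⟩
    · exact .inl h
    · exact .inr ⟨x, ⟨i, Finset.mem_univ _, hx⟩, h⟩

theorem Term.vars_lift {n : ℕ} (t : Term n) : t.lift.vars = t.vars := by
  induction t with
  | bvar i => rfl
  | fvar x => rfl
  | app k f ts ih =>
    simp only [Term.lift, Term.subst, Term.vars] at ih ⊢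
    simp only [ih]

theorem exists_mem_vars_liftSubst {n m : ℕ} {s : Fin n → Term m} {z : ℕ}
    (h : ∃ i, z ∈ (liftSubst s i).vars) : ∃ i, z ∈ (s i).vars := by
  obtain ⟨i, h⟩ := h
  revert h
  refine Fin.lastCases ?_ (fun i => ?_) i
  · simp [liftSubst, Term.vars]
  · simp only [liftSubst, Fin.snoc_castSucc, Term.vars_lift]
    exact fun h => ⟨i, h⟩

theorem Formula.vars_subst {n m : ℕ} {s : Fin n → Term m} {τ : ℕ → Term m} {A : Formula n} {z : ℕ}
    (h : z ∈ (A.subst s τ).vars) : (∃ i, z ∈ (s i).vars) ∨ ∃ x ∈ A.vars, z ∈ (τ x).vars := by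
  induction A generalizing m with
  | rel k R ts =>
    simp only [Formula.subst, Formula.vars, Finset.mem_biUnion] at h ⊢
    obtain ⟨i, -, hi⟩ := h
    rcases Term.vars_subst hi with h | ⟨x, hx, h⟩
    · exact .inl h
    · exact .inr ⟨x, ⟨i, Finset.mem_univ _, hx⟩, h⟩
  | neg A ih => exact ih h
  | and A B ih₁ ih₂ =>
    simp only [Formula.subst, Formula.vars, Finset.mem_union] at h ⊢
    rcases h with h | h
    · rcases ih₁ h with h | ⟨x, hx, h⟩
      exacts [.inl h, .inr ⟨x, .inl hx, h⟩]
    · rcases ih₂ h with h | ⟨x, hx, h⟩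
      exacts [.inl h, .inr ⟨x, .inr hx, h⟩]
  | or A B ih₁ ih₂ =>
    simp only [Formula.subst, Formula.vars, Finset.mem_union] at h ⊢
    rcases h with h | h
    · rcases ih₁ h with h | ⟨x, hx, h⟩
      exacts [.inl h, .inr ⟨x, .inl hx, h⟩]
    · rcases ih₂ h with h | ⟨x, hx, h⟩
      exacts [.inl h, .inr ⟨x, .inr hx, h⟩]
  | all A ih =>
    rcases ih (s := liftSubst s) h with h | ⟨x, hx, h⟩
    · exact .inl (exists_mem_vars_liftSubst h)
    · exact .inr ⟨x, hx, by rwa [Term.vars_lift] at h⟩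
  | ex A ih =>
    rcases ih (s := liftSubst s) h with h | ⟨x, hx, h⟩
    · exact .inl (exists_mem_vars_liftSubst h)
    · exact .inr ⟨x, hx, by rwa [Term.vars_lift] at h⟩

theorem Term.subst_congr {n m : ℕ} {s : Fin n → Term m} {τ τ' : ℕ → Term m} {t : Term n}
    (h : ∀ x ∈ t.vars, τ x = τ' x) : t.subst s τ = t.subst s τ' := by
  induction t with
  | bvar i => rfl
  | fvar x => exact h x (by simp [Term.vars])
  | app k f ts ih =>
    simp only [Term.subst]
    congr 1
    funext i
    exact ih i fun x hx => h x (Finset.mem_biUnion.2 ⟨i, Finset.mem_univ _, hx⟩)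

theorem Formula.subst_congr {n m : ℕ} {s : Fin n → Term m} {τ τ' : ℕ → Term m} {A : Formula n}
    (h : ∀ x ∈ A.vars, τ x = τ' x) : A.subst s τ = A.subst s τ' := by
  induction A generalizing m with
  | rel k R ts =>
    simp only [Formula.subst]
    congr 1
    funext i
    exact Term.subst_congr fun x hx => h x (Finset.mem_biUnion.2 ⟨i, Finset.mem_univ _, hx⟩)
  | neg A ih => exact congrArg Formula.neg (ih h)
  | and A B ih₁ ih₂ =>
    exact congrArg₂ Formula.and (ih₁ fun x hx => h x (Finset.mem_union_left _ hx))
      (ih₂ fun x hx => h x (Finset.mem_union_right _ hx))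
  | or A B ih₁ ih₂ =>
    exact congrArg₂ Formula.or (ih₁ fun x hx => h x (Finset.mem_union_left _ hx))
      (ih₂ fun x hx => h x (Finset.mem_union_right _ hx))
  | all A ih => exact congrArg Formula.all (ih fun x hx => by rw [h x hx])
  | ex A ih => exact congrArg Formula.ex (ih fun x hx => by rw [h x hx])

theorem Term.funs_subst_fvar {n m : ℕ} {s : Fin n → Term m} (hs : ∀ i, (s i).funs = ∅) (r : ℕ → ℕ)
    (t : Term n) : (t.subst s fun x => Term.fvar (r x)).funs = t.funs := by
  induction t with
  | bvar i => exact hs i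
  | fvar x => rfl
  | app k f ts ih => simp only [Term.subst, Term.funs, ih]

theorem Term.funs_lift {n : ℕ} (t : Term n) : t.lift.funs = t.funs :=
  Term.funs_subst_fvar (fun _ => rfl) id t

theorem Formula.funs_subst_fvar {n m : ℕ} {s : Fin n → Term m} (hs : ∀ i, (s i).funs = ∅)
    (r : ℕ → ℕ) (A : Formula n) : (A.subst s fun x => Term.fvar (r x)).funs = A.funs := by
  have key : ∀ {n m : ℕ} {s : Fin n → Term m}, (∀ i, (s i).funs = ∅) →
      ∀ i, (liftSubst s i).funs = ∅ := by
    intro n m s hs i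
    refine Fin.lastCases ?_ (fun i => ?_) i
    · simp [liftSubst, Term.funs]
    · simp only [liftSubst, Fin.snoc_castSucc, Term.funs_lift, hs]
  induction A generalizing m with
  | rel k R ts => simp only [Formula.subst, Formula.funs, Term.funs_subst_fvar hs]
  | neg A ih => exact ih hs
  | and A B ih₁ ih₂ => simp only [Formula.subst, Formula.funs, ih₁ hs, ih₂ hs]
  | or A B ih₁ ih₂ => simp only [Formula.subst, Formula.funs, ih₁ hs, ih₂ hs]
  | all A ih => exact ih (key hs)
  | ex A ih => exact ih (key hs)

/-- The formula obtained from `A` by turning the individual variable `y` into a place-holder. -/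
def Formula.abstract (y : ℕ) (A : Formula 0) : Formula 1 :=
  A.subst Fin.elim0 (Function.update Term.fvar y (Term.bvar 0))

theorem Formula.abstract_inst₁ (y : ℕ) (A : Formula 0) :
    (A.abstract y).inst₁ (Term.fvar y) = A := by
  rw [Formula.inst₁, Formula.inst, Formula.abstract, Formula.subst_subst]
  conv_rhs => rw [← A.subst_id]
  congr 1
  · funext i; exact i.elim0
  · funext x
    rcases eq_or_ne x y with rfl | h
    · simp [Term.subst]
    · simp [h, Term.subst]

theorem Formula.mem_vars_abstract {y z : ℕ} {A : Formula 0} (h : z ∈ (A.abstract y).vars) :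
    z ∈ A.vars ∧ z ≠ y := by
  rcases Formula.vars_subst h with ⟨i, -⟩ | ⟨x, hx, h⟩
  · exact i.elim0
  · rcases eq_or_ne x y with rfl | hxy
    · simp [Term.vars] at h
    · simp only [Function.update_of_ne hxy, Term.vars, Finset.mem_singleton] at h
      exact ⟨h ▸ hx, h ▸ hxy⟩

theorem Formula.dual_dual {n : ℕ} (A : Formula n) : A.dual.dual = A := by
  induction A <;> simp_all [Formula.dual]

/-- Atomic formulas and their negations. -/
def Formula.IsLiteral {n : ℕ} (A : Formula n) : Prop :=
  ∃ (k R : ℕ) (ts : Fin k → Term n), A = .rel k R ts ∨ A = .neg (.rel k R ts)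

/-- Dualization touches only binary connectives and quantifiers. Hence a datum reduced to literals
and its dual have the same matrix, and the two sides of Criss-Crossing can be compared directly. -/
theorem Formula.IsLiteral.dual {n : ℕ} {A : Formula n} (h : A.IsLiteral) : A.dual = A := by
  obtain ⟨k, R, ts, rfl | rfl⟩ := h <;> rfl

theorem Formula.IsLiteral.subst {n m : ℕ} {A : Formula n} (h : A.IsLiteral) (s : Fin n → Term m)
    (τ : ℕ → Term m) : (A.subst s τ).IsLiteral := by
  obtain ⟨k, R, ts, rfl | rfl⟩ := h
  · exact ⟨k, R, _, .inl rfl⟩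
  · exact ⟨k, R, _, .inr rfl⟩

theorem Formula.IsLiteral.rename {n : ℕ} {A : Formula n} (h : A.IsLiteral)
    (e : ℕ → Equiv.Perm ℕ) (p : Equiv.Perm ℕ) : (A.rename e p).IsLiteral := by
  obtain ⟨k, R, ts, rfl | rfl⟩ := h
  · exact ⟨k, R, _, .inl rfl⟩
  · exact ⟨k, R, _, .inr rfl⟩

/-! ### Four-valued semantics

Fixing a state `s` and asking which formulas have a truthmaker, or a falsity-maker, included in `s`
turns an FDEQ model into a structure in which truth and falsity of the atomic formulas are
independent of each other. -/

/-- A four-valued structure: `val true` gives the extensions and `val false` the anti-extensions of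
the predicate variables. -/
structure Interp (D : Type u) where
  /-- values of the individual variables -/
  var : ℕ → D
  /-- values of the functional variables -/
  func : (k : ℕ) → ℕ → (Fin k → D) → D
  /-- extensions and anti-extensions of the predicate variables -/
  val : Bool → (k : ℕ) → ℕ → (Fin k → D) → Prop

/-- The value of a term in a four-valued structure. -/
def Term.value {D : Type u} (I : Interp D) {n : ℕ} (a : Fin n → D) : Term n → D
  | bvar i => a i
  | fvar x => I.var x
  | app k f ts => I.func k f (fun i => (ts i).value I a)

/-- Truth (`true`) and falsity (`false`) of a formula in a four-valued structure. -/
def Formula.Holds {D : Type u} (I : Interp D) : {n : ℕ} → (Fin n → D) → Bool → Formula n → Prop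
  | _, a, b, rel k R ts => I.val b k R (fun i => (ts i).value I a)
  | _, a, b, neg A => A.Holds I a (!b)
  | _, a, true, and A B => A.Holds I a true ∧ B.Holds I a true
  | _, a, false, and A B => A.Holds I a false ∨ B.Holds I a false
  | _, a, true, or A B => A.Holds I a true ∨ B.Holds I a true
  | _, a, false, or A B => A.Holds I a false ∧ B.Holds I a false
  | _, a, true, all A => ∀ d : D, A.Holds I (Fin.snoc (α := fun _ => D) a d) true
  | _, a, false, all A => ∃ d : D, A.Holds I (Fin.snoc (α := fun _ => D) a d) false
  | _, a, true, ex A => ∃ d : D, A.Holds I (Fin.snoc (α := fun _ => D) a d) true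
  | _, a, false, ex A => ∀ d : D, A.Holds I (Fin.snoc (α := fun _ => D) a d) false

/-! ### The substitution lemma. -/

section Substitution

variable {D : Type u} (I : Interp D)

theorem Term.value_subst {n m : ℕ} (s : Fin n → Term m) (τ : ℕ → Term m) (a : Fin m → D)
    (t : Term n) : (t.subst s τ).value I a =
      t.value ⟨fun x => (τ x).value I a, I.func, I.val⟩ fun i => (s i).value I a := by
  induction t with
  | bvar i => rfl
  | fvar x => rfl
  | app k f ts ih => simp only [Term.subst, Term.value, ih]

theorem Term.value_lift {n : ℕ} (a : Fin n → D) (d : D) (t : Term n) :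
    t.lift.value I (Fin.snoc (α := fun _ => D) a d) = t.value I a := by
  rw [Term.lift, Term.value_subst]
  simp [Term.value]

theorem value_liftSubst {n m : ℕ} (s : Fin n → Term m) (a : Fin m → D) (d : D) :
    (fun i => (liftSubst s i).value I (Fin.snoc (α := fun _ => D) a d)) =
      Fin.snoc (α := fun _ => D) (fun i => (s i).value I a) d := by
  funext i
  refine Fin.lastCases ?_ (fun i => ?_) i
  · simp [liftSubst, Term.value]
  · simp [liftSubst, Term.value_lift]

theorem Formula.holds_subst {n m : ℕ} (s : Fin n → Term m) (τ : ℕ → Term m) (a : Fin m → D)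
    (b : Bool) (A : Formula n) : (A.subst s τ).Holds I a b ↔
      A.Holds ⟨fun x => (τ x).value I a, I.func, I.val⟩ (fun i => (s i).value I a) b := by
  -- Under a quantifier, the lifted substitution in the extended assignment amounts to extending the
  -- substituted assignment.
  have key : ∀ {n m : ℕ} (A : Formula (n + 1)) (s : Fin n → Term m) (τ : ℕ → Term m)
      (a : Fin m → D) (b : Bool) (d : D),
      A.Holds ⟨fun x => (τ x).lift.value I (Fin.snoc (α := fun _ => D) a d), I.func, I.val⟩
        (fun i => (liftSubst s i).value I (Fin.snoc (α := fun _ => D) a d)) b ↔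
      A.Holds ⟨fun x => (τ x).value I a, I.func, I.val⟩
        (Fin.snoc (α := fun _ => D) (fun i => (s i).value I a) d) b := by
    intro n m A s τ a b d
    rw [value_liftSubst]
    simp only [Term.value_lift]
  induction A generalizing m b with
  | rel k R ts => simp only [Formula.subst, Formula.Holds, Term.value_subst]
  | neg A ih => simp only [Formula.subst, Formula.Holds, ih]
  | and A B ih₁ ih₂ => cases b <;> simp only [Formula.subst, Formula.Holds, ih₁, ih₂]
  | or A B ih₁ ih₂ => cases b <;> simp only [Formula.subst, Formula.Holds, ih₁, ih₂]
  | all A ih =>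
    cases b
    · exact exists_congr fun d => (ih _ _ _ _).trans (key A s τ a false d)
    · exact forall_congr' fun d => (ih _ _ _ _).trans (key A s τ a true d)
  | ex A ih =>
    cases b
    · exact forall_congr' fun d => (ih _ _ _ _).trans (key A s τ a false d)
    · exact exists_congr fun d => (ih _ _ _ _).trans (key A s τ a true d)

theorem Formula.holds_inst₁ (A : Formula 1) (t : Term 0) (b : Bool) :
    (A.inst₁ t).Holds I Fin.elim0 b ↔
      A.Holds I (Fin.snoc (α := fun _ => D) Fin.elim0 (t.value I Fin.elim0)) b := by
  rw [Formula.inst₁, Formula.inst, Formula.holds_subst]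
  have : (fun _ => t.value I Fin.elim0 : Fin 1 → D) =
      Fin.snoc (α := fun _ => D) Fin.elim0 (t.value I Fin.elim0) := by
    funext i; rw [Subsingleton.elim i (Fin.last 0), Fin.snoc_last]
  rw [this]
  rfl

end Substitution

/-! ### Dependence on the variables that occur, and renaming. -/

section Congruence

variable {D : Type u} {I J : Interp D}

theorem Term.value_congr {n : ℕ} {a : Fin n → D} {t : Term n}
    (hv : ∀ x ∈ t.vars, I.var x = J.var x) (hf : ∀ g ∈ t.funs, I.func g.1 g.2 = J.func g.1 g.2) :
    t.value I a = t.value J a := by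
  induction t with
  | bvar i => rfl
  | fvar x => exact hv x (by simp [Term.vars])
  | app k f ts ih =>
    simp only [Term.value]
    rw [hf (k, f) (by simp [Term.funs])]
    congr 1
    funext i
    exact ih i (fun x hx => hv x (Finset.mem_biUnion.2 ⟨i, Finset.mem_univ _, hx⟩))
      (fun g hg => hf g (Finset.mem_insert_of_mem (Finset.mem_biUnion.2 ⟨i, Finset.mem_univ _, hg⟩)))

theorem Formula.holds_congr {n : ℕ} {a : Fin n → D} {b : Bool} {A : Formula n}
    (hval : I.val = J.val) (hv : ∀ x ∈ A.vars, I.var x = J.var x)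
    (hf : ∀ g ∈ A.funs, I.func g.1 g.2 = J.func g.1 g.2) :
    A.Holds I a b ↔ A.Holds J a b := by
  induction A generalizing b with
  | rel k R ts =>
    simp only [Formula.Holds, hval]
    refine iff_of_eq (congrArg _ (funext fun i => ?_))
    exact Term.value_congr (fun x hx => hv x (Finset.mem_biUnion.2 ⟨i, Finset.mem_univ _, hx⟩))
      (fun g hg => hf g (Finset.mem_biUnion.2 ⟨i, Finset.mem_univ _, hg⟩))
  | neg A ih => exact ih hv hf
  | and A B ih₁ ih₂ =>
    have h₁ := fun b => ih₁ (a := a) (b := b) (fun x hx => hv x (Finset.mem_union_left _ hx))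
      (fun x hx => hf x (Finset.mem_union_left _ hx))
    have h₂ := fun b => ih₂ (a := a) (b := b) (fun x hx => hv x (Finset.mem_union_right _ hx))
      (fun x hx => hf x (Finset.mem_union_right _ hx))
    cases b <;> simp only [Formula.Holds, h₁, h₂]
  | or A B ih₁ ih₂ =>
    have h₁ := fun b => ih₁ (a := a) (b := b) (fun x hx => hv x (Finset.mem_union_left _ hx))
      (fun x hx => hf x (Finset.mem_union_left _ hx))
    have h₂ := fun b => ih₂ (a := a) (b := b) (fun x hx => hv x (Finset.mem_union_right _ hx))
      (fun x hx => hf x (Finset.mem_union_right _ hx))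
    cases b <;> simp only [Formula.Holds, h₁, h₂]
  | all A ih =>
    have h := fun a b => ih (a := a) (b := b) hv hf
    cases b <;> simp only [Formula.Holds, h]
  | ex A ih =>
    have h := fun a b => ih (a := a) (b := b) hv hf
    cases b <;> simp only [Formula.Holds, h]

theorem Term.value_rename (e : ℕ → Equiv.Perm ℕ) (p : Equiv.Perm ℕ) {n : ℕ} (a : Fin n → D)
    (t : Term n) : (t.rename e p).value I a =
      t.value ⟨fun x => I.var (p x), fun k f => I.func k (e k f), I.val⟩ a := by
  induction t with
  | bvar i => rfl
  | fvar x => rfl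
  | app k f ts ih => simp only [Term.rename, Term.value, ih]

theorem Formula.holds_rename (e : ℕ → Equiv.Perm ℕ) (p : Equiv.Perm ℕ) {n : ℕ} (a : Fin n → D)
    (b : Bool) (A : Formula n) : (A.rename e p).Holds I a b ↔
      A.Holds ⟨fun x => I.var (p x), fun k f => I.func k (e k f), I.val⟩ a b := by
  induction A generalizing b with
  | rel k R ts => simp only [Formula.rename, Formula.Holds, Term.value_rename]
  | neg A ih => simp only [Formula.rename, Formula.Holds, ih]
  | and A B ih₁ ih₂ => cases b <;> simp only [Formula.rename, Formula.Holds, ih₁, ih₂]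
  | or A B ih₁ ih₂ => cases b <;> simp only [Formula.rename, Formula.Holds, ih₁, ih₂]
  | all A ih => cases b <;> simp only [Formula.rename, Formula.Holds, ih]
  | ex A ih => cases b <;> simp only [Formula.rename, Formula.Holds, ih]

end Congruence

/-- The structure in which exactly the untrue atomic formulas are false in the dual sense. -/
def Interp.compl {D : Type u} (I : Interp D) : Interp D :=
  ⟨I.var, I.func, fun b k R d => ¬ I.val b k R d⟩

theorem Term.value_compl {D : Type u} (I : Interp D) {n : ℕ} (a : Fin n → D) (t : Term n) :
    t.value I.compl a = t.value I a :=
  Term.value_congr (fun _ _ => rfl) fun _ _ => rfl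

/-- De Morgan duality. Truth and falsity are complemented separately, so negation, which only flips
`b`, commutes with the passage. This is what lets dual data be handled as data. -/
theorem Formula.holds_dual_compl {D : Type u} (I : Interp D) {n : ℕ} (a : Fin n → D) (b : Bool)
    (A : Formula n) : A.dual.Holds I.compl a b ↔ ¬ A.Holds I a b := by
  induction A generalizing b with
  | rel k R ts => simp only [Formula.dual, Formula.Holds, Term.value_compl]; rfl
  | neg A ih => simp only [Formula.dual, Formula.Holds, ih]
  | and A B ih₁ ih₂ => cases b <;> simp only [Formula.dual, Formula.Holds, ih₁, ih₂] <;> tauto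
  | or A B ih₁ ih₂ => cases b <;> simp only [Formula.dual, Formula.Holds, ih₁, ih₂] <;> tauto
  | all A ih => cases b <;> simp only [Formula.dual, Formula.Holds, ih] <;> push Not <;> rfl
  | ex A ih => cases b <;> simp only [Formula.dual, Formula.Holds, ih] <;> push Not <;> rfl

/-! ### Truthmakers included in a state -/

/-- The truthmakers (`true`) or the falsity-makers (`false`) of a proposition. -/
def side {S : Type v} (b : Bool) (p : Set (Set S) × Set (Set S)) : Set (Set S) :=
  bif b then p.1 else p.2

/-- `X` has an element included in `s`. -/
def Supports {S : Type v} (s : Set S) (X : Set (Set S)) : Prop := ∃ s' ∈ X, s' ⊆ s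

section Supports

variable {S : Type v} {s : Set S}

/-- A union lies in `s` exactly when each united state does; choice collects the witnesses in the
converse direction. This makes fusion a conjunction. -/
theorem supports_fusions {ι : Type*} {I : Set ι} {X : ι → Set (Set S)} :
    Supports s (fusions I X) ↔ ∀ i ∈ I, Supports s (X i) := by
  classical
  constructor
  · rintro ⟨_, ⟨c, hc, rfl⟩, hs⟩ i hi
    exact ⟨c i, hc i hi, (Set.subset_biUnion_of_mem hi).trans hs⟩
  · intro h
    -- Outside `I` the selection is arbitrary; the union ignores those values.
    choose! c hc using h
    exact ⟨_, ⟨c, fun i hi => (hc i hi).1, rfl⟩, Set.iUnion₂_subset fun i hi => (hc i hi).2⟩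

theorem supports_fusions₂ {X Y : Set (Set S)} :
    Supports s (fusions₂ X Y) ↔ Supports s X ∧ Supports s Y := by
  constructor
  · rintro ⟨_, ⟨a, ha, b, hb, rfl⟩, hs⟩
    exact ⟨⟨a, ha, Set.subset_union_left.trans hs⟩, ⟨b, hb, Set.subset_union_right.trans hs⟩⟩
  · rintro ⟨⟨a, ha, has⟩, ⟨b, hb, hbs⟩⟩
    exact ⟨_, ⟨a, ha, b, hb, rfl⟩, Set.union_subset has hbs⟩

theorem supports_union {X Y : Set (Set S)} :
    Supports s (X ∪ Y) ↔ Supports s X ∨ Supports s Y := by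
  simp only [Supports, Set.mem_union, or_and_right, exists_or]

theorem supports_iUnion {ι : Sort*} {X : ι → Set (Set S)} :
    Supports s (⋃ i, X i) ↔ ∃ i, Supports s (X i) := by
  simp only [Supports, Set.mem_iUnion]
  constructor
  · rintro ⟨s', ⟨i, hi⟩, hs⟩; exact ⟨i, s', hi, hs⟩
  · rintro ⟨i, s', hi, hs⟩; exact ⟨s', ⟨i, hi⟩, hs⟩

theorem supports_biUnion {ι : Type*} {p : ι → Prop} {X : ι → Set (Set S)} :
    Supports s (⋃ (i) (_ : p i), X i) ↔ ∃ i, p i ∧ Supports s (X i) := by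
  simp only [supports_iUnion, exists_prop]

/-- The four-valued structure given by an FDEQ model and a state. -/
def Model.interp {D : Type u} (M : Model D S) (s : Set S) : Interp D :=
  ⟨M.var, M.func, fun b k R d => Supports s (side b (M.pred k R d).1)⟩

theorem Term.eval_eq_value {D : Type u} (M : Model D S) (s : Set S) {n : ℕ} (a : Fin n → D)
    (t : Term n) : t.eval M a = t.value (M.interp s) a := by
  induction t with
  | bvar i => rfl
  | fvar x => rfl
  | app k f ts ih => simp only [Term.eval, Term.value, ih]; rfl

/-- Each semantic clause is a fusion or a union, which support turns into a conjunction or a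
disjunction over the same index set. -/
theorem Formula.supports_eval {D : Type u} (M : Model D S) (s : Set S) {n : ℕ} (a : Fin n → D)
    (b : Bool) (A : Formula n) : Supports s (side b (A.eval M a)) ↔ A.Holds (M.interp s) a b := by
  induction A generalizing b with
  | rel k R ts => simp only [Formula.eval, Formula.Holds, Term.eval_eq_value M s]; rfl
  | neg A ih =>
    simp only [Formula.Holds, ← ih, Formula.eval]
    cases b <;> rfl
  | and A B ih₁ ih₂ =>
    cases b <;> simp only [Formula.eval, Formula.Holds, ← ih₁, ← ih₂] <;>
      simp only [side, cond_true, cond_false, supports_union, supports_fusions₂]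
  | or A B ih₁ ih₂ =>
    cases b <;> simp only [Formula.eval, Formula.Holds, ← ih₁, ← ih₂] <;>
      simp only [side, cond_true, cond_false, supports_union, supports_fusions₂]
  | all A ih =>
    cases b <;> simp only [Formula.eval, Formula.Holds, ← ih] <;>
      simp only [side, cond_true, cond_false, supports_iUnion, supports_fusions, Set.mem_univ,
        forall_const]
  | ex A ih =>
    cases b <;> simp only [Formula.eval, Formula.Holds, ← ih] <;>
      simp only [side, cond_true, cond_false, supports_iUnion, supports_fusions, Set.mem_univ,
        forall_const]

theorem Formula.supports_truthmakers {D : Type u} (M : Model D S) (s : Set S) (A : Formula 0) :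
    Supports s (A.truthmakers M) ↔ A.Holds (M.interp s) Fin.elim0 true :=
  A.supports_eval M s Fin.elim0 true

end Supports

/-- Support is inherited by larger states, and a truthmaker supports its own formula; so it makes no
difference whether `s` is a truthmaker or merely includes one. -/
theorem formulaEntails_iff {A B : Formula 0} : FormulaEntails.{u, v} A B ↔
    ∀ (D : Type u) (S : Type v) (M : Model D S) (s : Set S),
      A.Holds (M.interp s) Fin.elim0 true → B.Holds (M.interp s) Fin.elim0 true := by
  simp only [← Formula.supports_truthmakers]
  constructor
  · rintro h D S M s ⟨s', hs', hss⟩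
    obtain ⟨s'', h₁, h₂⟩ := h D S M s' hs'
    exact ⟨s'', h₁, h₂.trans hss⟩
  · exact fun h D S M s hs => h D S M s ⟨s, hs, subset_rfl⟩

theorem fdeEntails_iff {Γ Δ : Set (Formula 0)} : FDEEntails.{v} Γ Δ ↔
    ∀ (S : Type v) (σ : (k R : ℕ) → (Fin k → Term 0) → Bilateral S) (s : Set S),
      (∀ A ∈ Γ, Supports s (side true (A.propEval σ))) →
        ∃ B ∈ Δ, Supports s (side true (B.propEval σ)) := by
  constructor
  · intro h S σ s hs
    obtain ⟨s', hs', hss⟩ := supports_fusions.2 hs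
    obtain ⟨B, hB, s'', h₁, h₂⟩ := h S σ s' hs'
    exact ⟨B, hB, s'', h₁, h₂.trans hss⟩
  · exact fun h S σ s hs => h S σ s (supports_fusions.1 ⟨s, hs, subset_rfl⟩)

theorem Fin.forall_snoc_iff {D : Type u} {n : ℕ} {p : (Fin (n + 1) → D) → Prop} :
    (∀ a, p a) ↔ ∀ (a : Fin n → D) (d : D), p (Fin.snoc (α := fun _ => D) a d) :=
  ⟨fun h _ _ => h _, fun h a => by simpa using h (Fin.init a) (a (Fin.last n))⟩

theorem Formula.holds_allClosure {D : Type u} (I : Interp D) {n : ℕ} (A : Formula n) :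
    A.allClosure.Holds I Fin.elim0 true ↔ ∀ a, A.Holds I a true := by
  induction n with
  | zero => simp [Formula.allClosure, Unique.forall_iff, Subsingleton.elim default Fin.elim0]
  | succ n ih => rw [Formula.allClosure, ih, Fin.forall_snoc_iff]; rfl

theorem Formula.holds_exClosure {D : Type u} (I : Interp D) {n : ℕ} (A : Formula n) :
    A.exClosure.Holds I Fin.elim0 true ↔ ∃ a, A.Holds I a true := by
  induction n with
  | zero => simp [Formula.exClosure, Unique.exists_iff, Subsingleton.elim default Fin.elim0]
  | succ n ih =>
    rw [Formula.exClosure, ih, ← not_iff_not, not_exists, not_exists,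
      Fin.forall_snoc_iff (p := fun a => ¬ A.Holds I a true)]
    simp only [Formula.Holds, not_exists]

/-! ### The Herbrand theorem -/

/-- The term structure in which the individual variable `x` has the value `τ x`. -/
def herbrand (w : Bool → (k : ℕ) → ℕ → (Fin k → Term 0) → Prop) (τ : ℕ → Term 0) :
    Interp (ULift.{u} (Term 0)) :=
  ⟨fun x => ⟨τ x⟩, fun k f ts => ⟨.app k f fun i => (ts i).down⟩,
    fun b k R ts => w b k R fun i => (ts i).down⟩

theorem Term.value_herbrand (w : Bool → (k : ℕ) → ℕ → (Fin k → Term 0) → Prop) (τ : ℕ → Term 0)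
    {n : ℕ} (a : Fin n → ULift.{u} (Term 0)) (t : Term n) :
    (t.value (herbrand w τ) a).down = t.subst (fun i => (a i).down) τ := by
  induction t with
  | bvar i => rfl
  | fvar x => rfl
  | app k f ts ih => simp only [Term.value, Term.subst, ← ih]; rfl

/-- The retraction of all terms to those built with the functional variables in `F`. -/
def Term.collapse (F : Finset FunVar) {n : ℕ} : Term n → Term n
  | bvar i => bvar i
  | fvar x => fvar x
  | app k f ts => if (k, f) ∈ F then app k f (fun i => (ts i).collapse F) else fvar 0

theorem Term.funs_collapse (F : Finset FunVar) {n : ℕ} (t : Term n) : (t.collapse F).funs ⊆ F := by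
  induction t with
  | bvar i => exact Finset.empty_subset _
  | fvar x => exact Finset.empty_subset _
  | app k f ts ih =>
    simp only [Term.collapse]
    split_ifs with h
    · exact Finset.insert_subset h (Finset.biUnion_subset.2 fun i _ => ih i)
    · exact Finset.empty_subset _

/-- The retraction does not disturb the functional variables of `t` itself, so it acts only on the
substituted terms. -/
theorem Term.collapse_subst {F : Finset FunVar} {n m : ℕ} {s : Fin n → Term m} {t : Term n}
    (h : t.funs ⊆ F) :
    (t.subst s Term.fvar).collapse F = t.subst (fun i => (s i).collapse F) Term.fvar := by
  induction t with
  | bvar i => rfl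
  | fvar x => rfl
  | app k f ts ih =>
    rw [Term.funs, Finset.insert_subset_iff, Finset.biUnion_subset] at h
    rw [Term.subst, Term.collapse, if_pos h.1, Term.subst]
    congr 1
    funext i
    exact ih i (h.2 i (Finset.mem_univ i))

/-- The induction shared by both directions of the Herbrand theorem. Agreement is required only for
atoms over `F`, since `Term.collapse` respects only those. -/
theorem Formula.supports_propEval_inst {D : Type u} {S : Type v} {I : Interp D} {s : Set S}
    {σ : (k R : ℕ) → (Fin k → Term 0) → Bilateral S} {F : Finset FunVar} {n : ℕ}
    {t : Fin n → Term 0} {a : Fin n → D}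
    (hσ : ∀ (b : Bool) (k R : ℕ) (ts : Fin k → Term n), (∀ i, (ts i).funs ⊆ F) →
      (Supports s (side b (σ k R fun i => (ts i).subst t Term.fvar).1) ↔
        I.val b k R fun i => (ts i).value I a))
    {A : Formula n} (hA : A.QuantifierFree) (hF : A.funs ⊆ F) (b : Bool) :
    Supports s (side b ((A.inst t).propEval σ)) ↔ A.Holds I a b := by
  rw [Formula.inst]
  induction A generalizing b with
  | rel k R ts =>
    rw [Formula.funs, Finset.biUnion_subset] at hF
    exact hσ b k R ts fun i => hF i (Finset.mem_univ i)
  | neg A ih =>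
    simp only [Formula.Holds, ← ih hσ hA hF]
    cases b <;> rfl
  | and A B ih₁ ih₂ =>
    rw [Formula.funs, Finset.union_subset_iff] at hF
    cases b <;> simp only [Formula.Holds, ← ih₁ hσ hA.1 hF.1, ← ih₂ hσ hA.2 hF.2] <;>
      simp only [Formula.subst, Formula.propEval, side, cond_true, cond_false, supports_union,
        supports_fusions₂]
  | or A B ih₁ ih₂ =>
    rw [Formula.funs, Finset.union_subset_iff] at hF
    cases b <;> simp only [Formula.Holds, ← ih₁ hσ hA.1 hF.1, ← ih₂ hσ hA.2 hF.2] <;>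
      simp only [Formula.subst, Formula.propEval, side, cond_true, cond_false, supports_union,
        supports_fusions₂]
  | all A ih => exact hA.elim
  | ex A ih => exact hA.elim

/-- Every four-valued structure comes from an FDEQ model over a single elementary situation. -/
theorem Interp.exists_model {D : Type u} (I : Interp D) :
    ∃ M : Model D PUnit.{v + 1}, M.interp ∅ = I := by
  classical
  -- Only `∅` is included in `∅`, so a side is supported iff it contains `∅`. The remaining freedom
  -- secures distinct sides: `{∅}` and the set of all states when both are supported, `∅` and
  -- `{univ}` when neither is. The latter needs an elementary situation to exist.
  have h : ∀ w : Bool → Prop, ∃ p : Bilateral PUnit.{v + 1},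
      ∀ b, Supports ∅ (side b p.1) ↔ w b := by
    intro w
    have hne : ({∅} : Set (Set PUnit.{v + 1})) ≠ Set.univ := fun h =>
      Set.univ_nonempty.ne_empty (Set.mem_singleton_iff.1 (h ▸ Set.mem_univ Set.univ))
    have hne' : (∅ : Set (Set PUnit.{v + 1})) ≠ {Set.univ} := (Set.singleton_nonempty _).ne_empty.symm
    by_cases h₁ : w true <;> by_cases h₂ : w false
    · exact ⟨⟨({∅}, Set.univ), hne⟩, by simp [Supports, side, h₁, h₂]⟩
    · exact ⟨⟨({∅}, ∅), (Set.singleton_nonempty _).ne_empty⟩, by simp [Supports, side, h₁, h₂]⟩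
    · exact ⟨⟨(∅, {∅}), (Set.singleton_nonempty _).ne_empty.symm⟩, by
        simp [Supports, side, h₁, h₂]⟩
    · have he : (∅ : Set PUnit.{v + 1}) ≠ Set.univ := Set.univ_nonempty.ne_empty.symm
      exact ⟨⟨(∅, {Set.univ}), hne'⟩, by simp [Supports, side, h₁, h₂, he]⟩
  choose p hp using h
  refine ⟨⟨I.var, I.func, fun k R d => p fun b => I.val b k R d⟩, ?_⟩
  obtain ⟨var, func, val⟩ := I
  simp only [Model.interp, hp]

theorem formulaEntails_allClosure_exClosure_iff {n m : ℕ} {A : Formula n} {B : Formula m}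
    (hA : A.QuantifierFree) (hB : B.QuantifierFree) :
    FormulaEntails.{u, v} A.allClosure B.exClosure ↔
      FDEEntails.{v} (herbrandInstances (A.funs ∪ B.funs) A)
        (herbrandInstances (A.funs ∪ B.funs) B) := by
  set F := A.funs ∪ B.funs
  have hAF : A.funs ⊆ F := Finset.subset_union_left
  have hBF : B.funs ⊆ F := Finset.subset_union_right
  rw [formulaEntails_iff, fdeEntails_iff]
  simp only [Formula.holds_allClosure, Formula.holds_exClosure]
  constructor
  · intro h S σ s hs
    -- The domain is the set of all terms, so that every functional variable is a total operation;
    -- atoms are looked up after the retraction, so only Herbrand instances are consulted.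
    let w : Bool → (k : ℕ) → ℕ → (Fin k → Term 0) → Prop := fun b k R ts =>
      Supports s (side b (σ k R fun i => (ts i).collapse F).1)
    obtain ⟨M, hM⟩ := (herbrand.{u} w Term.fvar).exists_model
    have key : ∀ {n : ℕ} {C : Formula n} (_ : C.QuantifierFree) (_ : C.funs ⊆ F)
        (a : Fin n → ULift.{u} (Term 0)),
        Supports s (side true ((C.inst fun i => (a i).down.collapse F).propEval σ)) ↔
          C.Holds (herbrand w Term.fvar) a true := by
      intro n C hC hCF a
      refine Formula.supports_propEval_inst (fun b k R ts hts => ?_) hC hCF true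
      simp only [herbrand, w]
      refine iff_of_eq (congrArg (fun t => Supports s (side b (σ k R t).1)) (funext fun i => ?_))
      rw [← Term.collapse_subst (hts i), ← Term.value_herbrand w]
      rfl
    obtain ⟨a, ha⟩ := h _ _ M ∅ fun a => by
      rw [hM, ← key hA hAF]
      exact hs _ ⟨_, fun i => Term.funs_collapse F _, rfl⟩
    rw [hM, ← key hB hBF] at ha
    exact ⟨_, ⟨_, fun i => Term.funs_collapse F _, rfl⟩, ha⟩
  · intro h D S M s hs
    -- An atom receives the proposition that the model assigns to the values of its terms.
    let σ : (k R : ℕ) → (Fin k → Term 0) → Bilateral S := fun k R ts =>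
      M.pred k R fun i => (ts i).value (M.interp s) Fin.elim0
    have key : ∀ {n : ℕ} {C : Formula n} (_ : C.QuantifierFree) (_ : C.funs ⊆ F)
        (t : Fin n → Term 0), Supports s (side true ((C.inst t).propEval σ)) ↔
          C.Holds (M.interp s) (fun i => (t i).value (M.interp s) Fin.elim0) true := by
      intro n C hC hCF t
      refine Formula.supports_propEval_inst (fun b k R ts _ => ?_) hC hCF true
      simp only [σ, Term.value_subst]
      rfl
    obtain ⟨_, ⟨t, -, rfl⟩, ht⟩ := h S σ s (by
      rintro _ ⟨t, -, rfl⟩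
      exact (key hA hAF t).2 (hs _))
    exact ⟨_, (key hB hBF t).1 ht⟩

/-! ### Four-valued semantics of data -/

section Sat

variable {D : Type u} (I : Interp D)

/-- Truth of a component (a conjunction). -/
def ComponentHolds (Γ : Finset (Formula 0)) : Prop := ∀ A ∈ Γ, A.Holds I Fin.elim0 true

/-- Truth of a matrix of a datum (a disjunction of conjunctions). -/
def DatumMatrix.Holds (m : DatumMatrix) : Prop := ∃ Γ ∈ m, ComponentHolds I Γ

/-- Truth of a datum. -/
def Datum.Sat (α : Datum) : Prop :=
  ∃ func : (k : ℕ) → ℕ → (Fin k → D) → D, (∀ k f, (k, f) ∉ α.funs → func k f = I.func k f) ∧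
    ∀ var : ℕ → D, (∀ x ∉ α.vars, var x = I.var x) → α.matrix.Holds ⟨var, func, I.val⟩

variable {I}

theorem componentHolds_insert {A : Formula 0} {Γ : Finset (Formula 0)} :
    ComponentHolds I (insert A Γ) ↔ A.Holds I Fin.elim0 true ∧ ComponentHolds I Γ := by
  simp [ComponentHolds]

theorem DatumMatrix.holds_insert {Γ : Finset (Formula 0)} {m : DatumMatrix} :
    DatumMatrix.Holds I (insert Γ m) ↔ ComponentHolds I Γ ∨ m.Holds I := by
  simp [DatumMatrix.Holds]

theorem DatumMatrix.mem_vars {m : DatumMatrix} {x : ℕ} :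
    x ∈ m.vars ↔ ∃ Γ ∈ m, ∃ A ∈ Γ, x ∈ A.vars := by
  simp [DatumMatrix.vars]

theorem DatumMatrix.mem_funs {m : DatumMatrix} {g : FunVar} :
    g ∈ m.funs ↔ ∃ Γ ∈ m, ∃ A ∈ Γ, g ∈ A.funs := by
  simp [DatumMatrix.funs]

theorem ComponentHolds.congr {J : Interp D} {Γ : Finset (Formula 0)} (h : ComponentHolds I Γ)
    (hval : I.val = J.val) (hv : ∀ x ∈ Γ.biUnion Formula.vars, I.var x = J.var x)
    (hf : ∀ g ∈ Γ.biUnion Formula.funs, I.func g.1 g.2 = J.func g.1 g.2) :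
    ComponentHolds J Γ := fun A hA =>
  (Formula.holds_congr hval (fun x hx => hv x (Finset.mem_biUnion.2 ⟨A, hA, hx⟩))
    fun g hg => hf g (Finset.mem_biUnion.2 ⟨A, hA, hg⟩)).1 (h A hA)

theorem DatumMatrix.Holds.congr {J : Interp D} {m : DatumMatrix} (h : m.Holds I)
    (hval : I.val = J.val) (hv : ∀ x ∈ m.vars, I.var x = J.var x)
    (hf : ∀ g ∈ m.funs, I.func g.1 g.2 = J.func g.1 g.2) : m.Holds J := by
  obtain ⟨Γ, hΓ, h⟩ := h
  exact ⟨Γ, hΓ, h.congr hval (fun x hx => hv x (Finset.mem_biUnion.2 ⟨Γ, hΓ, hx⟩))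
    fun g hg => hf g (Finset.mem_biUnion.2 ⟨Γ, hΓ, hg⟩)⟩

theorem Datum.Sat.mono {F : Finset FunVar} {X : Finset ℕ} {m m' : DatumMatrix}
    (h : ∀ J : Interp D, m.Holds J → m'.Holds J) (hs : Datum.Sat I ⟨F, X, m⟩) :
    Datum.Sat I ⟨F, X, m'⟩ := by
  obtain ⟨func, hf, hv⟩ := hs
  exact ⟨func, hf, fun var hvar => h _ (hv var hvar)⟩

/-- The value chosen for `g` can be reset to the one in `I`, as the matrix does not mention `g`. -/
theorem Datum.Sat.of_insert_fun {F : Finset FunVar} {X : Finset ℕ} {m : DatumMatrix} {g : FunVar}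
    (hg : g ∉ m.funs) (hs : Datum.Sat I ⟨insert g F, X, m⟩) : Datum.Sat I ⟨F, X, m⟩ := by
  classical
  obtain ⟨func, hf, hv⟩ := hs
  refine ⟨fun k f => if (k, f) = g then I.func k f else func k f, fun k f hkf => ?_,
    fun var hvar => (hv var hvar).congr rfl (fun _ _ => rfl) fun g' hg' => ?_⟩
  · by_cases h : (k, f) = g
    · simp only [if_pos h]
    · simp only [if_neg h]
      exact hf k f (by simpa [h] using hkf)
  · exact (if_neg (ne_of_mem_of_not_mem hg' hg)).symm

theorem Datum.Sat.of_insert_var {F : Finset FunVar} {X : Finset ℕ} {y : ℕ} {P P' : Formula 0}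
    {Γ : Finset (Formula 0)} {m : DatumMatrix} (hΓ : y ∉ Γ.biUnion Formula.vars)
    (hm : y ∉ m.vars)
    (h : ∀ J : Interp D, (∀ d, P'.Holds ⟨Function.update J.var y d, J.func, J.val⟩ Fin.elim0 true) →
      P.Holds J Fin.elim0 true)
    (hs : Datum.Sat I ⟨F, insert y X, insert (insert P' Γ) m⟩) :
    Datum.Sat I ⟨F, X, insert (insert P Γ) m⟩ := by
  obtain ⟨func, hf, hv⟩ := hs
  refine ⟨func, hf, fun var hvar => ?_⟩
  have key : ∀ d, ((P'.Holds ⟨Function.update var y d, func, I.val⟩ Fin.elim0 true) ∧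
      ComponentHolds ⟨var, func, I.val⟩ Γ) ∨ m.Holds ⟨var, func, I.val⟩ := by
    intro d
    have h₁ := hv (Function.update var y d) fun x hx => by
      simp only [Finset.mem_insert, not_or] at hx
      rw [Function.update_of_ne hx.1]
      exact hvar x hx.2
    rw [DatumMatrix.holds_insert, componentHolds_insert] at h₁
    refine h₁.imp (And.imp_right fun h => h.congr rfl (fun x hx => ?_) fun _ _ => rfl)
      fun h => h.congr rfl (fun x hx => ?_) fun _ _ => rfl
    · exact Function.update_of_ne (ne_of_mem_of_not_mem hx hΓ) _ _
    · exact Function.update_of_ne (ne_of_mem_of_not_mem hx hm) _ _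
  rw [DatumMatrix.holds_insert, componentHolds_insert]
  -- `Γ` and `m` do not depend on `y`: unless `m` holds, the first component must be the true one
  -- for every value of `y`. This is the distribution of `∀` over a disjunct without `y`.
  by_cases hmh : m.Holds ⟨var, func, I.val⟩
  · exact .inr hmh
  · simp only [hmh, or_false] at key
    exact .inl ⟨h _ fun d => (key d).1, (key (var y)).2⟩

/-- In a G-rule the lower datum entails the upper one. -/
theorem GRule.sat {α β : Datum} (h : GRule α β) (hs : β.Sat I) : α.Sat I := by
  have hvar : ∀ (J : Interp D) (y : ℕ) (A : Formula 1) (b : Bool) (d : D), y ∉ A.vars →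
      ((A.inst₁ (Term.fvar y)).Holds ⟨Function.update J.var y d, J.func, J.val⟩ Fin.elim0 b ↔
        A.Holds J (Fin.snoc (α := fun _ => D) Fin.elim0 d) b) := by
    intro J y A b d hy
    rw [Formula.holds_inst₁]
    simp only [Term.value, Function.update_self]
    exact Formula.holds_congr rfl (fun x hx => Function.update_of_ne (ne_of_mem_of_not_mem hx hy) _ _)
      fun _ _ => rfl
  cases h with
  | and | or | negNeg | negOr | negAnd =>
    refine hs.mono fun J => ?_
    simp only [DatumMatrix.holds_insert, componentHolds_insert, Formula.Holds, Bool.not_true,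
      Bool.not_false]
    tauto
  | all F X y A Γ ρ _ hA hΓ hρ =>
    refine hs.of_insert_var hΓ hρ fun J hJ => ?_
    simpa only [Formula.Holds, hvar J y A true _ hA] using hJ
  | negEx F X y A Γ ρ _ hA hΓ hρ =>
    refine hs.of_insert_var hΓ hρ fun J hJ => ?_
    simp only [Formula.Holds, Bool.not_true, hvar J y A false _ hA] at hJ ⊢
    exact hJ
  | ex F X g t A Γ ρ ht hF hA hΓ hρ =>
    -- The value of the Skolem term is a witness for the existential quantifier; after that `g` is
    -- vacuous.
    refine Datum.Sat.of_insert_fun (g := g) ?_ (hs.mono fun J => ?_)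
    · simp only [DatumMatrix.funs, Finset.biUnion_insert, Finset.mem_union, not_or, Formula.funs]
      exact ⟨⟨hA, hΓ⟩, hρ⟩
    · simp only [DatumMatrix.holds_insert, componentHolds_insert, Formula.holds_inst₁]
      exact Or.imp_left (And.imp_left fun h => ⟨_, h⟩)
  | negAll F X g t A Γ ρ ht hF hA hΓ hρ =>
    refine Datum.Sat.of_insert_fun (g := g) ?_ (hs.mono fun J => ?_)
    · simp only [DatumMatrix.funs, Finset.biUnion_insert, Finset.mem_union, not_or, Formula.funs]
      exact ⟨⟨hA, hΓ⟩, hρ⟩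
    · simp only [DatumMatrix.holds_insert, componentHolds_insert, Formula.Holds, Bool.not_true,
        Formula.holds_inst₁]
      exact Or.imp_left (And.imp_left fun h => ⟨_, h⟩)

theorem Datum.supports_truthmakers {S : Type v} (M : Model D S) (s : Set S) (α : Datum) :
    Supports s (α.truthmakers M) ↔ α.Sat (M.interp s) := by
  simp only [Datum.truthmakers, Set.mem_ofPred_eq, supports_biUnion, supports_fusions,
    Formula.supports_truthmakers]
  constructor
  · rintro ⟨N, ⟨h₁, h₂, h₃⟩, h⟩
    refine ⟨N.func, h₃, fun var hvar => ?_⟩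
    obtain ⟨Γ, hΓ, hh⟩ := h ⟨var, N.func, M.pred⟩ ⟨rfl, h₂.symm, fun x hx => by
      rw [h₁]; exact hvar x hx⟩
    exact ⟨Γ, hΓ, hh⟩
  · rintro ⟨func, hf, h⟩
    refine ⟨⟨M.var, func, M.pred⟩, ⟨rfl, rfl, hf⟩, ?_⟩
    rintro ⟨var, func', pred⟩ ⟨h₁, h₂, h₃⟩
    dsimp only at h₁ h₂ h₃
    subst h₁ h₂
    exact h var h₃

/-- Support of `δ` answers every choice of functions with values of the individual variables making
some formula of each component true; satisfaction of the dual in the complement would supply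
functions for which all such values leave a whole component untrue. -/
theorem DualDatum.not_sat_dual {S : Type v} (M : Model D S) (s : Set S) (δ : DualDatum)
    (h : Supports s (δ.truthmakers M)) : ¬ δ.dual.Sat (M.interp s).compl := by
  simp only [DualDatum.truthmakers, Set.mem_ofPred_eq, supports_biUnion, supports_fusions,
    Formula.supports_truthmakers] at h
  rintro ⟨func, hf, hs⟩
  obtain ⟨⟨var, func', pred⟩, ⟨h₁, h₂, h₃⟩, hP⟩ := h ⟨M.var, func, M.pred⟩ ⟨rfl, rfl, hf⟩
  dsimp only at h₁ h₂ h₃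
  subst h₁ h₂
  obtain ⟨Γ', hΓ', hh⟩ := hs var h₃
  obtain ⟨Γ, hΓ, rfl⟩ := Finset.mem_image.1 hΓ'
  obtain ⟨A, hA, hAh⟩ := hP Γ hΓ
  exact (A.holds_dual_compl _ Fin.elim0 true).1 (hh _ (Finset.mem_image_of_mem _ hA)) hAh

/-- The semantic content of entailment on which the completeness proof rests. -/
theorem Entails.not_sat {α : Datum} {δ : DualDatum} (h : Entails.{u, v} α δ) (I : Interp D) :
    ¬ (α.Sat I ∧ δ.dual.Sat I.compl) := by
  rintro ⟨hα, hδ⟩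
  obtain ⟨M, rfl⟩ := I.exists_model
  obtain ⟨s, hs, hs'⟩ := (α.supports_truthmakers M ∅).2 hα
  obtain ⟨s', h₁, h₂⟩ := h D _ M s hs
  exact δ.not_sat_dual M ∅ ⟨s', h₁, h₂.trans hs'⟩ hδ

end Sat

/-! ### Reduction of data to literals -/

/-- A weight that is decreased by the G-rules applied downwards. -/
def Formula.weight : {n : ℕ} → Formula n → ℕ
  | _, rel _ _ _ => 1
  | _, neg A => A.weight + 1
  -- The constant is 2, not 1, so that `¬(A ∨ B)` outweighs `¬A` and `¬B` together.
  | _, and A B => A.weight + B.weight + 2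
  | _, or A B => A.weight + B.weight + 2
  | _, all A => A.weight + 1
  | _, ex A => A.weight + 1

theorem Formula.weight_subst {n m : ℕ} (s : Fin n → Term m) (τ : ℕ → Term m) (A : Formula n) :
    (A.subst s τ).weight = A.weight := by
  induction A generalizing m <;> simp_all [Formula.subst, Formula.weight]

theorem Formula.weight_inst₁ (A : Formula 1) (t : Term 0) : (A.inst₁ t).weight = A.weight :=
  A.weight_subst _ _

/-- The weight of a component. -/
def componentWeight (Γ : Finset (Formula 0)) : ℕ := ∑ A ∈ Γ, A.weight

/-- The weight of a matrix. -/
def DatumMatrix.weight (m : DatumMatrix) : ℕ := ∑ Γ ∈ m, 3 ^ componentWeight Γ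

theorem Finset.sum_insert_le_add {ι : Type*} [DecidableEq ι] (f : ι → ℕ) (a : ι) (s : Finset ι) :
    ∑ i ∈ insert a s, f i ≤ f a + ∑ i ∈ s, f i := by
  by_cases h : a ∈ s
  · rw [Finset.insert_eq_of_mem h]; exact Nat.le_add_left _ _
  · rw [Finset.sum_insert h]

/-- With base 3, two components of smaller weight cost at most two thirds of the component they
replace; base 2 would allow equality. Coincidences with components of `ρ` only lower the sum. -/
theorem DatumMatrix.weight_lt {Γ Γ₁ Γ₂ : Finset (Formula 0)} {ρ : DatumMatrix} (hΓ : Γ ∉ ρ)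
    (h₁ : componentWeight Γ₁ < componentWeight Γ) (h₂ : componentWeight Γ₂ < componentWeight Γ) :
    DatumMatrix.weight (insert Γ₁ (insert Γ₂ ρ)) < DatumMatrix.weight (insert Γ ρ) := by
  have h := (Finset.sum_insert_le_add (fun Γ => 3 ^ componentWeight Γ) Γ₁ (insert Γ₂ ρ)).trans
    (Nat.add_le_add_left (Finset.sum_insert_le_add (fun Γ => 3 ^ componentWeight Γ) Γ₂ ρ) _)
  refine lt_of_le_of_lt h ?_
  rw [DatumMatrix.weight, Finset.sum_insert hΓ]
  have key : ∀ n < componentWeight Γ, 3 * 3 ^ n ≤ 3 ^ componentWeight Γ := fun n hn => by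
    rw [← pow_succ']; exact Nat.pow_le_pow_right (by norm_num) hn
  have h₁ := key _ h₁
  have h₂ := key _ h₂
  have : 0 < 3 ^ componentWeight Γ₁ := by positivity
  omega

theorem exists_notMem_finset_pair (k : ℕ) (W : Finset FunVar) : ∃ f, (k, f) ∉ W := by
  obtain ⟨f, hf⟩ := Infinite.exists_notMem_finset (W.image Prod.snd)
  exact ⟨f, fun h => hf (Finset.mem_image_of_mem Prod.snd h)⟩

theorem exists_isSkolemTerm (X : Finset ℕ) (W : Finset FunVar) :
    ∃ (g : FunVar) (t : Term 0), g ∉ W ∧ IsSkolemTerm g X t := by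
  obtain ⟨f, hf⟩ := exists_notMem_finset_pair X.card W
  refine ⟨(X.card, f), _, hf, fun i => X.orderEmbOfFin rfl i, (X.orderEmbOfFin rfl).injective, ?_,
    rfl⟩
  ext x
  simp

/-- All formulas of the matrix are literals. -/
def DatumMatrix.IsLiteral (m : DatumMatrix) : Prop := ∀ Γ ∈ m, ∀ A ∈ Γ, A.IsLiteral

/-- A formula that is not a literal can be broken down by a G-rule. -/
theorem exists_gRule {F : Finset FunVar} {X : Finset ℕ} {P : Formula 0} (hP : ¬ P.IsLiteral)
    {Γ : Finset (Formula 0)} (hΓ : P ∉ Γ) {ρ : DatumMatrix} (hρ : insert P Γ ∉ ρ) :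
    ∃ (F' : Finset FunVar) (X' : Finset ℕ) (m : DatumMatrix),
      GRule ⟨F, X, insert (insert P Γ) ρ⟩ ⟨F', X', m⟩ ∧
        m.weight < DatumMatrix.weight (insert (insert P Γ) ρ) := by
  have hw : componentWeight (insert P Γ) = P.weight + componentWeight Γ := Finset.sum_insert hΓ
  have hle : ∀ (A : Formula 0) Γ, componentWeight (insert A Γ) ≤ A.weight + componentWeight Γ :=
    fun A Γ => Finset.sum_insert_le_add _ A Γ
  have h₁ : ∀ Γ₁, componentWeight Γ₁ < componentWeight (insert P Γ) →
      DatumMatrix.weight (insert Γ₁ ρ) < DatumMatrix.weight (insert (insert P Γ) ρ) :=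
    fun Γ₁ h => by simpa using DatumMatrix.weight_lt hρ h h
  have h₂ := fun A B (h : A.weight < P.weight) (h' : B.weight < P.weight) =>
    DatumMatrix.weight_lt (Γ₁ := insert A Γ) (Γ₂ := insert B Γ) hρ
      (by have := hle A Γ; omega) (by have := hle B Γ; omega)
  have h₃ : ∀ A : Formula 0, A.weight < P.weight → DatumMatrix.weight (insert (insert A Γ) ρ) <
      DatumMatrix.weight (insert (insert P Γ) ρ) :=
    fun A h => h₁ _ (by have := hle A Γ; omega)
  have h₄ : ∀ A B : Formula 0, A.weight + B.weight < P.weight →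
      DatumMatrix.weight (insert (insert A (insert B Γ)) ρ) <
        DatumMatrix.weight (insert (insert P Γ) ρ) :=
    fun A B h => h₁ _ (by have := hle B Γ; have := hle A (insert B Γ); omega)
  have hv : ∀ A : Formula 1, ∃ y, y ∉ X ∧ y ∉ A.vars ∧ y ∉ Γ.biUnion Formula.vars ∧ y ∉ ρ.vars := by
    intro A
    obtain ⟨y, hy⟩ :=
      Infinite.exists_notMem_finset (X ∪ (A.vars ∪ (Γ.biUnion Formula.vars ∪ ρ.vars)))
    simp only [Finset.mem_union, not_or] at hy
    exact ⟨y, hy⟩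
  have hg : ∀ A : Formula 1, ∃ g t, IsSkolemTerm g X t ∧ g ∉ F ∧ g ∉ A.funs ∧
      g ∉ Γ.biUnion Formula.funs ∧ g ∉ ρ.funs := by
    intro A
    obtain ⟨g, t, hg, ht⟩ := exists_isSkolemTerm X (F ∪ (A.funs ∪ (Γ.biUnion Formula.funs ∪ ρ.funs)))
    simp only [Finset.mem_union, not_or] at hg
    exact ⟨g, t, ht, hg⟩
  cases P with
  | rel k R ts => exact (hP ⟨k, R, ts, .inl rfl⟩).elim
  | and A B => exact ⟨_, _, _, .and F X A B Γ ρ, h₄ _ _ (by simp [Formula.weight])⟩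
  | or A B =>
    exact ⟨_, _, _, .or F X A B Γ ρ,
      h₂ _ _ (by simp only [Formula.weight]; omega) (by simp only [Formula.weight]; omega)⟩
  | all A =>
    obtain ⟨y, a, b, c, d⟩ := hv A
    exact ⟨_, _, _, .all F X y A Γ ρ a b c d,
      h₃ _ (by simp only [Formula.weight, Formula.weight_inst₁]; omega)⟩
  | ex A =>
    obtain ⟨g, t, ht, a, b, c, d⟩ := hg A
    exact ⟨_, _, _, .ex F X g t A Γ ρ ht a b c d,
      h₃ _ (by simp only [Formula.weight, Formula.weight_inst₁]; omega)⟩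
  | neg P =>
    cases P with
    | rel k R ts => exact (hP ⟨k, R, ts, .inr rfl⟩).elim
    | neg A => exact ⟨_, _, _, .negNeg F X A Γ ρ, h₃ _ (by simp only [Formula.weight]; omega)⟩
    | or A B =>
      exact ⟨_, _, _, .negOr F X A B Γ ρ, h₄ _ _ (by simp only [Formula.weight]; omega)⟩
    | and A B =>
      exact ⟨_, _, _, .negAnd F X A B Γ ρ,
        h₂ _ _ (by simp only [Formula.weight]; omega) (by simp only [Formula.weight]; omega)⟩
    | ex A =>
      obtain ⟨y, a, b, c, d⟩ := hv A
      exact ⟨_, _, _, .negEx F X y A Γ ρ a b c d,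
        h₃ _ (by simp only [Formula.weight, Formula.weight_inst₁]; omega)⟩
    | all A =>
      obtain ⟨g, t, ht, a, b, c, d⟩ := hg A
      exact ⟨_, _, _, .negAll F X g t A Γ ρ ht a b c d,
        h₃ _ (by simp only [Formula.weight, Formula.weight_inst₁]; omega)⟩

/-- Grounding rules are applied downwards until only literals remain. Deducibility runs down and
satisfaction runs back up, so a structure for the reduced datum is one for `α`. -/
theorem exists_literal_datum (α : Datum) : ∃ β : Datum, DCDeducible α β ∧ β.matrix.IsLiteral ∧
    ∀ {D : Type u} (I : Interp D), β.Sat I → α.Sat I := by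
  induction h : α.matrix.weight using Nat.strong_induction_on generalizing α with
  | _ n ih =>
    subst h
    by_cases hα : α.matrix.IsLiteral
    · exact ⟨α, .refl, hα, fun I h => h⟩
    simp only [DatumMatrix.IsLiteral, not_forall] at hα
    obtain ⟨Γ, hΓ, P, hPΓ, hP⟩ := hα
    -- The rules allow the displayed formula or component to recur in the context. Erasing it there
    -- first makes it really disappear, so the weight drops.
    obtain ⟨F', X', m, hr, hlt⟩ := exists_gRule (F := α.funs) (X := α.vars) hP
      (Finset.notMem_erase P Γ) (ρ := α.matrix.erase Γ)
      (by rw [Finset.insert_erase hPΓ]; exact Finset.notMem_erase Γ _)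
    rw [Finset.insert_erase hPΓ, Finset.insert_erase hΓ] at hr hlt
    obtain ⟨β, h₁, h₂, h₃⟩ := ih _ hlt ⟨F', X', m⟩ rfl
    exact ⟨β, .head (.inl hr) h₁, h₂, fun I h => hr.sat (h₃ I h)⟩

section Expansion

open scoped FinsetFamily

/-! ### Distributive normal forms inside the calculus -/

/-- Interdeducibility by G-rules. -/
def GEquiv (α β : Datum) : Prop := Relation.ReflTransGen (fun α β => GRule α β ∨ GRule β α) α β

theorem GEquiv.symm {α β : Datum} (h : GEquiv α β) : GEquiv β α := by
  induction h with
  | refl => exact .refl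
  | tail _ h ih => exact .head h.symm ih

theorem GEquiv.dcDeducible {α β : Datum} (h : GEquiv α β) : DCDeducible α β := by
  induction h with
  | refl => exact .refl
  | tail _ h ih => exact ih.tail (h.elim .inl fun h => .inr (.inl h))

/-- Interdeducibility by G-rules of two parts of a matrix in the context of any other part. -/
def MatrixEquiv (a b : DatumMatrix) : Prop :=
  ∀ F X ρ, GEquiv ⟨F, X, a ∪ ρ⟩ ⟨F, X, b ∪ ρ⟩

theorem MatrixEquiv.refl (a : DatumMatrix) : MatrixEquiv a a := fun _ _ _ => .refl

theorem MatrixEquiv.trans {a b c : DatumMatrix} (h : MatrixEquiv a b) (h' : MatrixEquiv b c) :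
    MatrixEquiv a c := fun F X ρ => Relation.ReflTransGen.trans (h F X ρ) (h' F X ρ)

theorem MatrixEquiv.union {a b c d : DatumMatrix} (h : MatrixEquiv a b) (h' : MatrixEquiv c d) :
    MatrixEquiv (a ∪ c) (b ∪ d) := fun F X ρ => by
  have h₁ := h F X (c ∪ ρ)
  have h₂ := h' F X (b ∪ ρ)
  rw [Finset.union_left_comm c, Finset.union_left_comm d] at h₂
  rw [Finset.union_assoc, Finset.union_assoc]
  exact Relation.ReflTransGen.trans h₁ h₂

/-- Interdeducibility by G-rules of two parts of a matrix in the context of any other part and of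
any formulas conjoined with it. -/
def Expands (a b : DatumMatrix) : Prop := ∀ Γ, MatrixEquiv (a ⊻ {Γ}) (b ⊻ {Γ})

theorem Expands.refl (a : DatumMatrix) : Expands a a := fun _ => .refl _

theorem Expands.trans {a b c : DatumMatrix} (h : Expands a b) (h' : Expands b c) : Expands a c :=
  fun Γ => (h Γ).trans (h' Γ)

theorem Expands.union {a b c d : DatumMatrix} (h : Expands a b) (h' : Expands c d) :
    Expands (a ∪ c) (b ∪ d) := fun Γ => by
  rw [Finset.sups_union_left, Finset.sups_union_left]
  exact (h Γ).union (h' Γ)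

/-- `⊻` unites components pairwise: it is the conjunction of two matrices, multiplied out. A factor
`c` is the disjunction of its single components, and `Expands` treats each of these. -/
theorem Expands.matrixEquiv_sups {a b : DatumMatrix} (h : Expands a b) (c : DatumMatrix) :
    MatrixEquiv (a ⊻ c) (b ⊻ c) := by
  induction c using Finset.induction_on with
  | empty => rw [Finset.sups_empty, Finset.sups_empty]; exact .refl _
  | insert Γ c _ ih =>
    rw [Finset.insert_eq, Finset.sups_union_right, Finset.sups_union_right]
    exact (h Γ).union ih

theorem Expands.matrixEquiv {a b : DatumMatrix} (h : Expands a b) : MatrixEquiv a b := by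
  have := h ∅
  simpa using this

theorem Expands.sups {a b c d : DatumMatrix} (h : Expands a b) (h' : Expands c d) :
    Expands (a ⊻ c) (b ⊻ d) := by
  have key : ∀ {a b : DatumMatrix} (c : DatumMatrix), Expands a b → Expands (a ⊻ c) (b ⊻ c) := by
    intro a b c h Γ
    rw [Finset.sups_assoc, Finset.sups_assoc]
    exact h.matrixEquiv_sups _
  refine (key c h).trans ?_
  rw [Finset.sups_comm b c, Finset.sups_comm b d]
  exact key b h'

theorem expands_and (A B : Formula 0) : Expands {{A.and B}} ({{A}} ⊻ {{B}}) := fun Γ F X ρ => by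
  simp only [Finset.singleton_sups_singleton, Finset.sup_eq_union, Finset.singleton_union,
    Finset.insert_union]
  exact .single (.inl (.and F X A B Γ ρ))

theorem expands_or (A B : Formula 0) : Expands {{A.or B}} ({{A}} ∪ {{B}}) := fun Γ F X ρ => by
  rw [Finset.sups_union_left]
  simp only [Finset.singleton_sups_singleton, Finset.sup_eq_union, Finset.singleton_union,
    Finset.insert_union]
  exact .single (.inl (.or F X A B Γ ρ))

/-- One formula serves for all substitutions `σ` at once, as needed for folding a matrix and
unfolding its renamed copies. There is no formula for the empty conjunction. -/
theorem exists_conjunction {Γ : Finset (Formula 0)} (hΓ : Γ.Nonempty) :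
    ∃ A : Formula 0, ∀ σ : ℕ → Term 0,
      Expands {{A.substVars σ}} {Γ.image (Formula.substVars σ)} := by
  induction hΓ using Finset.Nonempty.cons_induction with
  | singleton A => exact ⟨A, fun σ => by rw [Finset.image_singleton]; exact .refl _⟩
  | cons A Γ _ _ ih =>
    obtain ⟨B, hB⟩ := ih
    refine ⟨A.and B, fun σ => (expands_and (A.substVars σ) (B.substVars σ)).trans ?_⟩
    have := (Expands.refl {{A.substVars σ}}).sups (hB σ)
    simpa only [Finset.singleton_sups_singleton, Finset.sup_eq_union, Finset.singleton_union,
      Finset.cons_eq_insert, Finset.image_insert] using this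

theorem exists_disjunction {m : DatumMatrix} (hm : m.Nonempty) (hm' : ∅ ∉ m) :
    ∃ A : Formula 0, ∀ σ : ℕ → Term 0,
      Expands {{A.substVars σ}} (m.map (Formula.substVars σ)) := by
  induction hm using Finset.Nonempty.cons_induction with
  | singleton Γ =>
    obtain ⟨A, hA⟩ := exists_conjunction (Γ := Γ)
      (Finset.nonempty_iff_ne_empty.2 fun h => hm' (by simp [h]))
    exact ⟨A, fun σ => by rw [DatumMatrix.map, Finset.image_singleton]; exact hA σ⟩
  | cons Γ m _ _ ih =>
    rw [Finset.mem_cons, not_or] at hm'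
    obtain ⟨A, hA⟩ := exists_conjunction (Finset.nonempty_iff_ne_empty.2 (Ne.symm hm'.1))
    obtain ⟨B, hB⟩ := ih hm'.2
    refine ⟨A.or B, fun σ => (expands_or (A.substVars σ) (B.substVars σ)).trans ?_⟩
    rw [Finset.cons_eq_insert, DatumMatrix.map, Finset.image_insert, Finset.insert_eq]
    exact (hA σ).union (hB σ)

/-- The conjunction of the first `k` of the instances `m σ₀, m σ₁, …`, multiplied out. -/
noncomputable def DatumMatrix.copies (m : DatumMatrix) (σ : ℕ → ℕ → Term 0) : ℕ → DatumMatrix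
  | 0 => {∅}
  | k + 1 => m.map (Formula.substVars (σ k)) ⊻ m.copies σ k

theorem DatumMatrix.exists_subset_of_mem_copies {m : DatumMatrix} {σ : ℕ → ℕ → Term 0} {k : ℕ}
    {Γ : Finset (Formula 0)} (h : Γ ∈ m.copies σ k) {i : ℕ} (hi : i < k) :
    ∃ Θ ∈ m, Θ.image (Formula.substVars (σ i)) ⊆ Γ := by
  induction k generalizing Γ with
  | zero => omega
  | succ k ih =>
    obtain ⟨Γ₁, h₁, Γ₂, h₂, rfl⟩ := Finset.mem_sups.1 h
    rcases Nat.lt_succ_iff_lt_or_eq.1 hi with hi | rfl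
    · obtain ⟨Θ, hΘ, hs⟩ := ih h₂ hi
      exact ⟨Θ, hΘ, hs.trans Finset.subset_union_right⟩
    · obtain ⟨Θ, hΘ, rfl⟩ := Finset.mem_image.1 h₁
      exact ⟨Θ, hΘ, Finset.subset_union_left⟩

theorem DatumMatrix.exists_of_mem_copies {m : DatumMatrix} {σ : ℕ → ℕ → Term 0} {k : ℕ}
    {Γ : Finset (Formula 0)} (h : Γ ∈ m.copies σ k) {A : Formula 0} (hA : A ∈ Γ) :
    ∃ i, ∃ Θ ∈ m, ∃ B ∈ Θ, A = B.substVars (σ i) := by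
  induction k generalizing Γ with
  | zero => simp [(Finset.mem_singleton.1 h : Γ = ∅)] at hA
  | succ k ih =>
    obtain ⟨Γ₁, h₁, Γ₂, h₂, rfl⟩ := Finset.mem_sups.1 h
    rcases Finset.mem_union.1 hA with hA | hA
    · obtain ⟨Θ, hΘ, rfl⟩ := Finset.mem_image.1 h₁
      obtain ⟨B, hB, rfl⟩ := Finset.mem_image.1 hA
      exact ⟨k, Θ, hΘ, B, hB, rfl⟩
    · exact ih h₂ hA

/-- For `k = 0` both sides are the single empty component, the unit of `⊻`. -/
theorem expands_copies {m : DatumMatrix} {D : Formula 0}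
    (hD : ∀ σ : ℕ → Term 0, Expands {{D.substVars σ}} (m.map (Formula.substVars σ)))
    (σ : ℕ → ℕ → Term 0) (k : ℕ) :
    Expands {(Finset.range k).image fun i => D.substVars (σ i)} (m.copies σ k) := by
  induction k with
  | zero => exact .refl _
  | succ k ih =>
    have := (hD (σ k)).sups ih
    rwa [Finset.singleton_sups_singleton, Finset.sup_eq_union, Finset.singleton_union,
      ← Finset.image_insert (fun i => D.substVars (σ i)), ← Finset.range_add_one] at this

/-! ### Universal closure and multiplication -/

theorem DCDeducible.of_subset (F : Finset FunVar) (X : Finset ℕ) {Γ Γ' : Finset (Formula 0)}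
    (h : Γ ⊆ Γ') : DCDeducible ⟨F, X, {Γ'}⟩ ⟨F, X, {Γ}⟩ := by
  have := SRule.del F X Γ Γ' ∅
  rw [Finset.union_eq_right.2 h] at this
  exact .single (.inr (.inr (.inl this)))

/-- Instantiation of a universal quantification with a fresh variable of the prefix. -/
theorem DCDeducible.instantiate {F : Finset FunVar} {Y : Finset ℕ} {Γ : Finset (Formula 0)}
    {A : Formula 1} {z : ℕ} (hA : A.all ∈ Γ) (hY : z ∉ Y) (hΓ : z ∉ Γ.biUnion Formula.vars) :
    DCDeducible ⟨F, Y, {Γ}⟩ ⟨F, insert z Y, {insert (A.inst₁ (Term.fvar z)) Γ}⟩ := by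
  have := GRule.all F Y z A Γ ∅ hY (fun h => hΓ (Finset.mem_biUnion.2 ⟨_, hA, h⟩)) hΓ
    (by simp [DatumMatrix.vars])
  -- As the context may contain the displayed formula, the quantification survives its instantiation
  -- and can be used again.
  rw [Finset.insert_eq_of_mem hA] at this
  exact .single (.inl this)

/-- `C` is the universal closure of `D` over `X`. The last clause produces a fresh copy of `D`
beside `Γ`, which keeps `C`, so it can be repeated. Induction passes from `D` to its quantification
over `y`. -/
theorem exists_universal_closure (X : Finset ℕ) (D : Formula 0) :
    ∃ C : Formula 0, (∀ F, GEquiv ⟨F, X, {{D}}⟩ ⟨F, ∅, {{C}}⟩) ∧ C.vars ⊆ D.vars ∧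
      ∀ (F : Finset FunVar) (Y : Finset ℕ) (Γ : Finset (Formula 0)) (r : ℕ → ℕ), C ∈ Γ →
        Set.InjOn r X →
        (∀ x ∈ X, r x ∉ Y ∧ r x ∉ Γ.biUnion Formula.vars ∧ r x ∉ D.vars) →
        (∀ x ∉ X, r x = x) →
        DCDeducible ⟨F, Y, {Γ}⟩
          ⟨F, Y ∪ X.image r, {insert (D.substVars fun x => Term.fvar (r x)) Γ}⟩ := by
  induction X using Finset.induction_on generalizing D with
  | empty =>
    refine ⟨D, fun F => .refl, subset_rfl, fun F Y Γ r hC _ _ hr => ?_⟩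
    obtain rfl : r = id := funext fun x => hr x (Finset.notMem_empty x)
    have : (D.substVars fun x => Term.fvar (id x)) = D := D.substVars_fvar
    rw [this, Finset.insert_eq_of_mem hC, Finset.image_empty, Finset.union_empty]
    exact .refl
  | insert y X hy ih =>
    obtain ⟨C, hup, hvars, hdown⟩ := ih (D.abstract y).all
    have hD : (D.abstract y).all.vars ⊆ D.vars := fun z hz => (Formula.mem_vars_abstract hz).1
    refine ⟨C, fun F => ?_, hvars.trans hD, fun F Y Γ r hC hinj hfresh hr => ?_⟩
    · refine Relation.ReflTransGen.head (.inr ?_) (hup F)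
      have := GRule.all F X y (D.abstract y) ∅ ∅ hy (fun h => (Formula.mem_vars_abstract h).2 rfl)
        (by simp) (by simp [DatumMatrix.vars])
      rwa [Formula.abstract_inst₁] at this
    · have hne : ∀ x ∈ X, x ≠ y := fun x hx => ne_of_mem_of_not_mem hx hy
      have hupd : ∀ x ∈ X, Function.update r y y x = r x := fun x hx =>
        Function.update_of_ne (hne x hx) _ _
      have himage : X.image (Function.update r y y) = X.image r := Finset.image_congr hupd
      -- The induction hypothesis wants a renaming that is the identity off `X`, so `y` is held
      -- fixed until its own quantifier is instantiated.
      have h₁ := hdown F Y Γ (Function.update r y y) hC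
        (fun a ha b hb h => hinj (Finset.mem_insert_of_mem ha) (Finset.mem_insert_of_mem hb)
          (by rwa [hupd a ha, hupd b hb] at h))
        (fun x hx => by
          rw [hupd x hx]
          have h := hfresh x (Finset.mem_insert_of_mem hx)
          exact ⟨h.1, h.2.1, fun h' => h.2.2 (hD h')⟩)
        (fun x hx => by
          rcases eq_or_ne x y with rfl | hxy
          · exact Function.update_self _ _ _
          · rw [Function.update_of_ne hxy]
            exact hr x (by simp [hxy, hx]))
      rw [himage] at h₁
      refine h₁.trans ?_
      obtain ⟨hzY, hzΓ, hzD⟩ := hfresh y (Finset.mem_insert_self y X)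
      have hzX : r y ∉ X.image r := fun h => by
        obtain ⟨x, hx, hxy⟩ := Finset.mem_image.1 h
        exact hne x hx (hinj (Finset.mem_insert_of_mem hx) (Finset.mem_insert_self y X) hxy)
      -- A free variable of the renamed quantification is some `r x` with `x ∈ X`, excluded by
      -- injectivity, or a variable of `D`, excluded by freshness.
      have hzC : r y ∉ ((D.abstract y).all.substVars
          fun x => Term.fvar (Function.update r y y x)).vars := fun h => by
        rcases Formula.vars_subst h with ⟨i, -⟩ | ⟨x, hx, h⟩
        · exact i.elim0
        · obtain ⟨hxD, hxy⟩ := Formula.mem_vars_abstract hx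
          rw [Term.vars, Finset.mem_singleton, Function.update_of_ne hxy] at h
          by_cases hxX : x ∈ X
          · exact hzX (h ▸ Finset.mem_image_of_mem r hxX)
          · rw [hr x (by simp [hxy, hxX])] at h
            exact hzD (h ▸ hxD)
      have h₂ := DCDeducible.instantiate (F := F) (Y := Y ∪ X.image r) (z := r y)
        (A := (D.abstract y).subst (liftSubst Term.bvar)
          fun x => Term.fvar (Function.update r y y x))
        (Γ := insert ((D.abstract y).all.substVars
          fun x => Term.fvar (Function.update r y y x)) Γ)
        (Finset.mem_insert_self _ _) (by simp only [Finset.mem_union, not_or]; exact ⟨hzY, hzX⟩)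
        (by simp only [Finset.biUnion_insert, Finset.mem_union, not_or]; exact ⟨hzC, hzΓ⟩)
      have h₃ : ((D.abstract y).subst (liftSubst Term.bvar)
          fun x => Term.fvar (Function.update r y y x)).inst₁ (Term.fvar (r y)) =
          D.substVars fun x => Term.fvar (r x) := by
        rw [Formula.inst₁, Formula.inst, Formula.abstract, Formula.subst_subst,
          Formula.subst_subst, Formula.substVars, liftSubst_bvar]
        congr 1
        · funext i; exact i.elim0
        · funext x
          rcases eq_or_ne x y with rfl | hxy
          · simp [Term.subst]
          · simp [hxy, Term.subst]
      rw [h₃] at h₂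
      rw [Finset.image_insert, Finset.union_insert]
      -- Deletes the intermediate formula, in which `y` is still quantified.
      refine h₂.trans (DCDeducible.of_subset _ _ ?_)
      exact Finset.insert_subset_insert _ (Finset.subset_insert _ _)

/-- From a literal matrix one can deduce the conjunction of any number of copies of it, in which
the prefix variables have been renamed apart; it has the conjunction of given instances of the
original matrix as an instance. -/
theorem exists_multiplication (F : Finset FunVar) (X : Finset ℕ) {m : DatumMatrix}
    (hm : ∅ ∉ m) (hlit : m.IsLiteral) (k : ℕ) (T : ℕ → ℕ → Term 0)
    (hT : ∀ i, ∀ x ∉ X, T i x = Term.fvar x) :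
    ∃ (Y : Finset ℕ) (m' : DatumMatrix) (θ : ℕ → Term 0),
      DCDeducible ⟨F, X, m⟩ ⟨F, Y, m'⟩ ∧ m'.IsLiteral ∧ m'.funs ⊆ m.funs ∧
      (∀ x ∉ Y, θ x = Term.fvar x) ∧
      ∀ Γ ∈ m', ∀ i < k, ∃ Θ ∈ m,
        Θ.image (Formula.substVars (T i)) ⊆ Γ.image (Formula.substVars θ) := by
  rcases m.eq_empty_or_nonempty with rfl | hne
  · exact ⟨X, ∅, Term.fvar, .refl, hlit, subset_rfl, fun _ _ => rfl, by simp⟩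
  obtain ⟨D, hD⟩ := exists_disjunction hne hm
  obtain ⟨C, hup, hCD, hdown⟩ := exists_universal_closure X D
  obtain ⟨N, hN⟩ : ∃ N, ∀ x ∈ D.vars ∪ m.vars, x < N :=
    ⟨(D.vars ∪ m.vars).sup id + 1, fun x hx => Nat.lt_succ_of_le (Finset.le_sup (f := id) hx)⟩
  -- The pairing function keeps the copies apart from one another; the shift by `N` keeps them apart
  -- from all variables already in use.
  let r : ℕ → ℕ → ℕ := fun i x => if x ∈ X then N + Nat.pair i x else x
  have hrX : ∀ i, ∀ x ∈ X, r i x = N + Nat.pair i x := fun i x hx => if_pos hx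
  have hrX' : ∀ i, ∀ x ∉ X, r i x = x := fun i x hx => if_neg hx
  let Y : ℕ → Finset ℕ := fun j => (Finset.range j).biUnion fun i => X.image (r i)
  have hmemY : ∀ {j z}, z ∈ Y j ↔ ∃ i < j, ∃ x ∈ X, z = N + Nat.pair i x := by
    intro j z
    simp only [Y, Finset.mem_biUnion, Finset.mem_range, Finset.mem_image]
    refine exists_congr fun i => and_congr_right fun _ => exists_congr fun x =>
      and_congr_right fun hx => ?_
    rw [hrX i x hx, eq_comm]
  let σ : ℕ → ℕ → Term 0 := fun i x => Term.fvar (r i x)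
  let Γ : ℕ → Finset (Formula 0) := fun j => (Finset.range j).image fun i => D.substVars (σ i)
  have hΓvars : ∀ {j z}, z ∈ (insert C (Γ j)).biUnion Formula.vars → z < N ∨ z ∈ Y j := by
    intro j z hz
    obtain ⟨B, hB, hz⟩ := Finset.mem_biUnion.1 hz
    rcases Finset.mem_insert.1 hB with h | hB
    · exact .inl (hN z (Finset.mem_union_left _ (hCD (h ▸ hz))))
    · obtain ⟨i, hi, rfl⟩ := Finset.mem_image.1 hB
      rcases Formula.vars_subst hz with ⟨i, -⟩ | ⟨x, hx, hzx⟩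
      · exact i.elim0
      · simp only [σ, Term.vars, Finset.mem_singleton] at hzx
        by_cases hxX : x ∈ X
        · rw [hrX i x hxX] at hzx
          exact .inr (hmemY.2 ⟨i, Finset.mem_range.1 hi, x, hxX, hzx⟩)
        · rw [hrX' i x hxX] at hzx
          exact .inl (hzx ▸ hN x (Finset.mem_union_left _ hx))
  have hchain : ∀ j, DCDeducible ⟨F, ∅, {{C}}⟩ ⟨F, Y j, {insert C (Γ j)}⟩ := by
    intro j
    induction j with
    | zero => exact .refl
    | succ j ih =>
      refine ih.trans ?_
      have hnotY : ∀ x, N + Nat.pair j x ∉ Y j := fun x h => by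
        obtain ⟨i, hi, x', -, h⟩ := hmemY.1 h
        have := (Nat.pair_eq_pair.1 (Nat.add_left_cancel h)).1
        omega
      have h := hdown F (Y j) (insert C (Γ j)) (r j) (Finset.mem_insert_self _ _)
        (fun a ha b hb h => by
          rw [hrX j a ha, hrX j b hb] at h
          exact (Nat.pair_eq_pair.1 (Nat.add_left_cancel h)).2)
        (fun x hx => by
          rw [hrX j x hx]
          refine ⟨hnotY x, fun h => ?_, fun h => ?_⟩
          · rcases hΓvars h with h | h
            · omega
            · exact hnotY x h
          · have := hN _ (Finset.mem_union_left _ h)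
            omega)
        (hrX' j)
      have hY : Y (j + 1) = Y j ∪ X.image (r j) := by
        simp only [Y, Finset.range_add_one, Finset.biUnion_insert, Finset.union_comm]
      have hΓ : Γ (j + 1) = insert (D.substVars (σ j)) (Γ j) := by
        simp only [Γ, Finset.range_add_one, Finset.image_insert]
      rw [hY, hΓ, Finset.insert_comm]
      exact h
  -- Decoding `z - N` recovers the copy and the original variable, so `θ` after the `i`-th renaming
  -- acts as `T i` on the formulas of `m`.
  let θ : ℕ → Term 0 := fun z =>
    if z ∈ Y k then T (Nat.unpair (z - N)).1 (Nat.unpair (z - N)).2 else Term.fvar z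
  refine ⟨Y k, m.copies σ k, θ, ?_, ?_, ?_, fun x hx => if_neg hx, ?_⟩
  · have h₁ : DCDeducible ⟨F, X, m⟩ ⟨F, X, {{D}}⟩ := by
      have h := ((hD Term.fvar).matrixEquiv F X ∅).symm.dcDeducible
      have hid : Formula.substVars Term.fvar = id := funext Formula.substVars_fvar
      simpa only [Finset.union_empty, DatumMatrix.map, hid, Finset.image_id, Finset.image_id',
        id] using h
    have h₂ := ((expands_copies hD σ k).matrixEquiv F (Y k) ∅).dcDeducible
    rw [Finset.union_empty, Finset.union_empty] at h₂
    -- Fold to `D`, close to `C`, instantiate `k` times, delete `C`, multiply out.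
    exact h₁.trans ((hup F).dcDeducible.trans ((hchain k).trans
      ((DCDeducible.of_subset _ _ (Finset.subset_insert _ _)).trans h₂)))
  · intro Γ hΓ A hA
    obtain ⟨i, Θ, hΘ, B, hB, rfl⟩ := DatumMatrix.exists_of_mem_copies hΓ hA
    exact (hlit Θ hΘ B hB).subst _ _
  · intro g hg
    obtain ⟨Γ, hΓ, A, hA, hg⟩ := DatumMatrix.mem_funs.1 hg
    obtain ⟨i, Θ, hΘ, B, hB, rfl⟩ := DatumMatrix.exists_of_mem_copies hΓ hA
    rw [Formula.substVars, Formula.funs_subst_fvar (fun _ => rfl)] at hg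
    exact DatumMatrix.mem_funs.2 ⟨Θ, hΘ, B, hB, hg⟩
  · intro Γ hΓ i hi
    obtain ⟨Θ, hΘ, hsub⟩ := DatumMatrix.exists_subset_of_mem_copies hΓ hi
    refine ⟨Θ, hΘ, ?_⟩
    refine subset_trans (fun A hA => ?_) (Finset.image_subset_image hsub)
    obtain ⟨B, hB, rfl⟩ := Finset.mem_image.1 hA
    refine Finset.mem_image.2 ⟨_, Finset.mem_image_of_mem _ hB, ?_⟩
    rw [Formula.substVars_substVars]
    refine Formula.subst_congr fun x hx => ?_
    simp only [σ, Term.subst, θ]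
    by_cases hxX : x ∈ X
    · rw [hrX i x hxX, if_pos (hmemY.2 ⟨i, hi, x, hxX, rfl⟩), Nat.add_sub_cancel_left,
        Nat.unpair_pair]
    · rw [hrX' i x hxX, if_neg, hT i x hxX]
      intro h
      obtain ⟨i, -, x', -, rfl⟩ := hmemY.1 h
      have := hN _ (Finset.mem_union_right _ (DatumMatrix.mem_vars.2 ⟨Θ, hΘ, B, hB, hx⟩))
      omega

end Expansion

/-! ### Renaming the functional variables of the prefix -/

theorem Term.mem_funs_rename {e : ℕ → Equiv.Perm ℕ} {p : Equiv.Perm ℕ} {n : ℕ} {t : Term n}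
    {g : FunVar} (h : g ∈ (t.rename e p).funs) : ∃ f ∈ t.funs, g = (f.1, e f.1 f.2) := by
  induction t with
  | bvar i => simp [Term.rename, Term.funs] at h
  | fvar x => simp [Term.rename, Term.funs] at h
  | app k f ts ih =>
    simp only [Term.rename, Term.funs, Finset.mem_insert, Finset.mem_biUnion] at h ⊢
    rcases h with rfl | ⟨i, -, hi⟩
    · exact ⟨(k, f), .inl rfl, rfl⟩
    · obtain ⟨f, hf, rfl⟩ := ih i hi
      exact ⟨f, .inr ⟨i, Finset.mem_univ i, hf⟩, rfl⟩

theorem Formula.mem_funs_rename {e : ℕ → Equiv.Perm ℕ} {p : Equiv.Perm ℕ} {n : ℕ} {A : Formula n}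
    {g : FunVar} (h : g ∈ (A.rename e p).funs) : ∃ f ∈ A.funs, g = (f.1, e f.1 f.2) := by
  induction A with
  | rel k R ts =>
    simp only [Formula.rename, Formula.funs, Finset.mem_biUnion] at h ⊢
    obtain ⟨i, hi, h⟩ := h
    obtain ⟨f, hf, rfl⟩ := Term.mem_funs_rename h
    exact ⟨f, ⟨i, hi, hf⟩, rfl⟩
  | neg A ih | all A ih | ex A ih => exact ih h
  | and A B ih₁ ih₂ | or A B ih₁ ih₂ =>
    simp only [Formula.rename, Formula.funs, Finset.mem_union] at h ⊢
    rcases h with h | h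
    · obtain ⟨f, hf, rfl⟩ := ih₁ h; exact ⟨f, .inl hf, rfl⟩
    · obtain ⟨f, hf, rfl⟩ := ih₂ h; exact ⟨f, .inr hf, rfl⟩

/-- The functional variables in `F` can be exchanged with functional variables outside `W`, in such
a way that the other elements of `W` are fixed. -/
theorem exists_perm_away (F W : Finset FunVar) : ∃ e : ℕ → Equiv.Perm ℕ,
    (∀ f ∈ F, (f.1, e f.1 f.2) ∉ W) ∧ ∀ f ∈ W, f ∉ F → e f.1 f.2 = f.2 := by
  obtain ⟨N, hN⟩ : ∃ N, ∀ f ∈ F ∪ W, f.2 < N :=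
    ⟨(F ∪ W).sup Prod.snd + 1, fun f hf => Nat.lt_succ_of_le (Finset.le_sup (f := Prod.snd) hf)⟩
  have hF : ∀ k j, (k, j) ∈ F → j < N := fun k j h => hN (k, j) (Finset.mem_union_left _ h)
  have hW : ∀ k j, (k, j) ∈ W → j < N := fun k j h => hN (k, j) (Finset.mem_union_right _ h)
  -- Exchanges `j` and `j + N` for each `(k, j) ∈ F`. All indices in `F` and `W` lie below `N`, so
  -- this is an involution and its new indices avoid `W`.
  let φ : ℕ → ℕ → ℕ := fun k j =>
    if (k, j) ∈ F then j + N else if N ≤ j ∧ (k, j - N) ∈ F then j - N else j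
  have hφ : ∀ k, Function.Involutive (φ k) := by
    intro k j
    simp only [φ]
    by_cases h₁ : (k, j) ∈ F
    · have h₂ : (k, j + N) ∉ F := fun h => by have := hF _ _ h; omega
      simp [h₁, h₂]
    · by_cases h₂ : N ≤ j ∧ (k, j - N) ∈ F
      · simp [h₁, h₂, Nat.sub_add_cancel h₂.1]
      · simp [h₁, h₂]
  refine ⟨fun k => Function.Involutive.toPerm (φ k) (hφ k), fun f hf h => ?_, fun f hfW hfF => ?_⟩
  · have h' : φ f.1 f.2 = f.2 + N := if_pos hf
    change (f.1, φ f.1 f.2) ∈ W at h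
    rw [h'] at h
    have := hW _ _ h
    omega
  · have h := hW _ _ hfW
    exact (if_neg hfF).trans (if_neg fun h' => by omega)

/-- Provides the disjointness of functional variables demanded by Criss-Crossing. -/
theorem Datum.exists_renaming (α : Datum) (W : Finset FunVar) : ∃ β : Datum,
    α.SameUpToRenaming β ∧ Disjoint β.funs W ∧ β.matrix.funs ⊆ α.matrix.funs ∪ β.funs ∧
    (α.matrix.IsLiteral → β.matrix.IsLiteral) ∧
    ∀ {D : Type u} (I : Interp D), β.Sat I → α.Sat I := by
  classical
  obtain ⟨F, X, m⟩ := α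
  -- The variables of `m` are avoided too, lest a renamed variable capture a free one.
  obtain ⟨e, he, hfix⟩ := exists_perm_away F (W ∪ m.funs)
  have hfix' : ∀ g ∈ m.funs, g ∉ F → e g.1 g.2 = g.2 := fun g hg =>
    hfix g (Finset.mem_union_right _ hg)
  refine ⟨⟨F.image fun g => (g.1, e g.1 g.2), X, m.map (Formula.rename e 1)⟩,
    ⟨e, 1, hfix', fun _ _ _ => rfl, rfl, by simp, rfl⟩, ?_, ?_, ?_, ?_⟩
  · refine Finset.disjoint_left.2 fun g hg hgW => ?_
    obtain ⟨f, hf, rfl⟩ := Finset.mem_image.1 hg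
    exact he f hf (Finset.mem_union_left _ hgW)
  · intro g hg
    obtain ⟨Γ, hΓ, A, hA, hg⟩ := DatumMatrix.mem_funs.1 hg
    obtain ⟨Γ, hΓ', rfl⟩ := Finset.mem_image.1 hΓ
    obtain ⟨A, hA', rfl⟩ := Finset.mem_image.1 hA
    obtain ⟨f, hf, rfl⟩ := Formula.mem_funs_rename hg
    have hfm : f ∈ m.funs := DatumMatrix.mem_funs.2 ⟨Γ, hΓ', A, hA', hf⟩
    by_cases hfF : f ∈ F
    · exact Finset.mem_union_right _ (Finset.mem_image_of_mem _ hfF)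
    · rw [hfix' f hfm hfF]
      exact Finset.mem_union_left _ hfm
  · intro hlit Γ hΓ A hA
    obtain ⟨Γ, hΓ', rfl⟩ := Finset.mem_image.1 hΓ
    obtain ⟨A, hA', rfl⟩ := Finset.mem_image.1 hA
    exact (hlit Γ hΓ' A hA').rename _ _
  · rintro D I ⟨func, hf, h⟩
    refine ⟨fun k f => if (k, f) ∈ F then func k (e k f) else I.func k f, fun k f hkf => if_neg hkf,
      fun var hvar => ?_⟩
    obtain ⟨Γ, hΓ, hh⟩ := h var hvar
    obtain ⟨Γ, hΓ', rfl⟩ := Finset.mem_image.1 hΓ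
    refine ⟨Γ, hΓ', fun A hA => ?_⟩
    have hA' := hh _ (Finset.mem_image_of_mem _ hA)
    rw [Formula.holds_rename] at hA'
    refine (Formula.holds_congr ?_ (fun x hx => ?_) fun g hg => ?_).1 hA'
    · rfl
    · rfl
    have hgm : g ∈ m.funs := DatumMatrix.mem_funs.2 ⟨Γ, hΓ', A, hA, hg⟩
    by_cases hgF : g ∈ F
    · exact (if_pos hgF).symm
    · refine Eq.trans ?_ (if_neg hgF).symm
      simp only [hfix' g hgm hgF]
      refine hf _ _ fun h => ?_
      obtain ⟨f, hfF, hfg⟩ := Finset.mem_image.1 h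
      refine he f hfF (Finset.mem_union_right _ ?_)
      rw [hfg]
      exact hgm

/-! ### Compactness -/

theorem Finset.exists_nat_enumeration {ι : Type*} [Inhabited ι] (s : Finset ι) :
    ∃ (k : ℕ) (T : ℕ → ι), ∀ a ∈ s, ∃ i < k, T i = a := by
  refine ⟨s.toList.length, fun i => s.toList.getD i default, fun a ha => ?_⟩
  obtain ⟨i, hi, rfl⟩ := List.mem_iff_getElem.1 (Finset.mem_toList.2 ha)
  exact ⟨i, hi, List.getD_eq_getElem _ _ hi⟩

/-- The substitutions for the individual variables in `X`. -/
abbrev SubstOn (X : Finset ℕ) : Type := {τ : ℕ → Term 0 // ∀ x ∉ X, τ x = Term.fvar x}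

instance (X : Finset ℕ) : Inhabited (SubstOn X) := ⟨⟨Term.fvar, fun _ _ => rfl⟩⟩

/-- The extensions and anti-extensions determined by a valuation of the literals. -/
def literalVal (v : Formula 0 → Prop) : Bool → (k : ℕ) → ℕ → (Fin k → Term 0) → Prop :=
  fun b k R ts => v (bif b then .rel k R ts else .neg (.rel k R ts))

/-- Evaluation in a term structure is substitution. An atom and its negation are valued
independently, so `v` may be arbitrary. -/
theorem Formula.IsLiteral.holds_herbrand {A : Formula 0} (h : A.IsLiteral) (v : Formula 0 → Prop)
    (τ : ℕ → Term 0) :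
    A.Holds (herbrand.{u} (literalVal v) τ) Fin.elim0 true ↔ v (A.substVars τ) := by
  have hval : ∀ {k : ℕ} (ts : Fin k → Term 0),
      (fun i => ((ts i).value (herbrand.{u} (literalVal v) τ) Fin.elim0).down) =
        fun i => (ts i).subst Term.bvar τ := fun ts => funext fun i =>
    (Term.value_herbrand _ _ _ _).trans
      (congrArg (fun s => (ts i).subst s τ) (funext fun i => i.elim0))
  obtain ⟨k, R, ts, rfl | rfl⟩ := h
  · exact iff_of_eq (congrArg (fun ts => v (.rel k R ts)) (hval ts))
  · exact iff_of_eq (congrArg (fun ts => v (.neg (.rel k R ts))) (hval ts))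

/-- If `m` and the dual of `m'` have no common Herbrand model, then this is due to an overlap of the
components of finitely many of their instances. -/
theorem exists_finite_instances {F G : Finset FunVar} {X Y : Finset ℕ} {m m' : DatumMatrix}
    (hm : m.IsLiteral) (hm' : m'.IsLiteral)
    (H : ∀ I : Interp (ULift.{u} (Term 0)),
      ¬ (Datum.Sat I ⟨F, X, m⟩ ∧ Datum.Sat I.compl ⟨G, Y, m'⟩)) :
    ∃ (s : Finset (SubstOn X)) (s' : Finset (SubstOn Y)), ∀ (c : SubstOn X → Finset (Formula 0))
      (d : SubstOn Y → Finset (Formula 0)), (∀ τ, c τ ∈ m) → (∀ τ, d τ ∈ m') →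
      ∃ τ ∈ s, ∃ τ' ∈ s', ∃ A, A ∈ (c τ).image (Formula.substVars τ.1) ∧
        A ∈ (d τ').image (Formula.substVars τ'.1) := by
  classical
  by_contra hcon
  push Not at hcon
  -- Substitutions for both sides are put into one sum type, and each choice is padded with an idle
  -- second coordinate, so that all choices range over the finite type `m × m'`.
  have hg : ∀ s : Finset (SubstOn X ⊕ SubstOn Y), ∃ g : SubstOn X ⊕ SubstOn Y → m × m',
      ∀ τ, .inl τ ∈ s → ∀ τ', .inr τ' ∈ s →
        ∀ A ∈ (g (.inl τ)).1.1.image (Formula.substVars τ.1),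
          A ∉ (g (.inr τ')).2.1.image (Formula.substVars τ'.1) := by
    intro s
    obtain ⟨c, d, hc, hd, h⟩ := hcon s.toLeft s.toRight
    exact ⟨Sum.elim (fun τ => (⟨c τ, hc τ⟩, ⟨d default, hd _⟩))
      (fun τ' => (⟨c default, hc _⟩, ⟨d τ', hd τ'⟩)), fun τ hτ τ' hτ' =>
      h τ (Finset.mem_toLeft.2 hτ) τ' (Finset.mem_toRight.2 hτ')⟩
  choose g hg using hg
  -- Compactness: on every finite set `χ` agrees with a selection made for some larger finite set.
  -- Two-element sets suffice to rule out overlaps.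
  obtain ⟨χ, hχ⟩ := Finset.rado_selection g
  have hχ' : ∀ (τ : SubstOn X) (τ' : SubstOn Y),
      ∀ A ∈ (χ (.inl τ)).1.1.image (Formula.substVars τ.1),
        A ∉ (χ (.inr τ')).2.1.image (Formula.substVars τ'.1) := by
    intro τ τ'
    obtain ⟨t, ht, h⟩ := hχ {.inl τ, .inr τ'}
    rw [h (.inl τ) (by simp), h (.inr τ') (by simp)]
    exact hg t τ (ht (by simp)) τ' (ht (by simp))
  have hvar : ∀ {Z : Finset ℕ} {var : ℕ → ULift.{u} (Term 0)}, (∀ x ∉ Z, var x = ⟨Term.fvar x⟩) →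
      ∀ x ∉ Z, (var x).down = Term.fvar x := fun h x hx => by rw [h x hx]
  let v : Formula 0 → Prop := fun A =>
    ∃ τ : SubstOn X, A ∈ (χ (.inl τ)).1.1.image (Formula.substVars τ.1)
  -- The functional prefixes are witnessed by term formation itself, and values of the prefix
  -- variables in the term structure are just substitutions for them.
  refine H (herbrand (literalVal v) Term.fvar) ⟨⟨_, fun _ _ _ => rfl, fun var hX => ?_⟩,
    ⟨_, fun _ _ _ => rfl, fun var hY => ?_⟩⟩
  · let τ : SubstOn X := ⟨fun x => (var x).down, hvar hX⟩
    exact ⟨_, (χ (.inl τ)).1.2, fun A hA => ((hm _ (χ (.inl τ)).1.2 A hA).holds_herbrand v τ.1).2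
      ⟨τ, Finset.mem_image_of_mem _ hA⟩⟩
  · let τ' : SubstOn Y := ⟨fun x => (var x).down, hvar hY⟩
    -- The complement of the structure for `v` is the structure for the negation of `v`.
    refine ⟨_, (χ (.inr τ')).2.2, fun A hA => ((hm' _ (χ (.inr τ')).2.2 A hA).holds_herbrand
      (fun A => ¬ v A) τ'.1).2 ?_⟩
    rintro ⟨τ, hτ⟩
    exact hχ' τ τ' _ hτ (Finset.mem_image_of_mem _ hA)

/-! ### Deductive completeness -/

/-- The dual datum dual to a datum. -/
noncomputable def Datum.dual (α : Datum) : DualDatum :=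
  ⟨α.funs, α.vars, α.matrix.map Formula.dual⟩

theorem DatumMatrix.map_dual_map_dual (m : DatumMatrix) :
    (m.map Formula.dual).map Formula.dual = m := by
  simp [DatumMatrix.map, Finset.image_image, Function.comp_def, Formula.dual_dual]

theorem Datum.dual_dual (α : Datum) : α.dual.dual = α := by
  simp [Datum.dual, DualDatum.dual, DatumMatrix.map_dual_map_dual]

theorem DualDatum.dual_dual (δ : DualDatum) : δ.dual.dual = δ := by
  simp [Datum.dual, DualDatum.dual, DatumMatrix.map_dual_map_dual]

/-- FDEQDDC steps are by definition reversed FDEQDC steps between duals, and dualization is an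
involution. -/
theorem DCDeducible.dual {α β : Datum} (h : DCDeducible α β) : DDCDeducible β.dual α.dual := by
  induction h with
  | refl => exact .refl
  | tail _ h ih => exact .head (by rwa [DDCStep, Datum.dual_dual, Datum.dual_dual]) ih

theorem DatumMatrix.IsLiteral.map_dual {m : DatumMatrix} (h : m.IsLiteral) :
    m.map Formula.dual = m := by
  have : ∀ Γ ∈ m, Γ.image Formula.dual = Γ := fun Γ hΓ =>
    (Finset.image_congr fun A hA => (h Γ hΓ A hA).dual).trans Finset.image_id
  exact (Finset.image_congr this).trans Finset.image_id

theorem HCDeducible.of_literal {α β γ : Datum} {δ : DualDatum} (hβ : DCDeducible α β)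
    (hγ : DCDeducible δ.dual γ) (hlit : γ.matrix.IsLiteral)
    (hd : Disjoint β.funs γ.matrix.funs) (hd' : Disjoint γ.funs β.matrix.funs)
    (θ : SubstOn β.vars) (θ' : SubstOn γ.vars)
    (h : ∀ Γ ∈ β.matrix, ∀ Δ ∈ γ.matrix, ∃ A, A ∈ Γ.image (Formula.substVars θ.1) ∧
      A ∈ Δ.image (Formula.substVars θ'.1)) : HCDeducible α δ := by
  have hdual := hγ.dual
  rw [DualDatum.dual_dual] at hdual
  refine ⟨β, γ.dual, hβ, ⟨?_, hd', _, _, ⟨θ.1, θ.2, rfl⟩, ⟨θ'.1, θ'.2, rfl⟩, ?_⟩, hdual⟩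
  · rwa [Datum.dual, hlit.map_dual]
  · intro Γ hΓ Δ hΔ
    obtain ⟨Γ, hΓ', rfl⟩ := Finset.mem_image.1 hΓ
    obtain ⟨Δ, hΔ', rfl⟩ := Finset.mem_image.1 hΔ
    rw [Datum.dual, hlit.map_dual] at hΔ'
    exact h Γ hΓ' Δ hΔ'

theorem Entails.hcDeducible {α : Datum} {δ : DualDatum} (h : Entails.{u, v} α δ) :
    HCDeducible α δ := by
  obtain ⟨α₁, hα₁, hαl₁, hαs₁⟩ := exists_literal_datum.{u} α
  obtain ⟨γ₁, hγ₁, hγl₁, hγs₁⟩ := exists_literal_datum.{u} δ.dual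
  obtain ⟨⟨F, X, m⟩, hα₂, hαd, hαf, hαl, hαs⟩ := α₁.exists_renaming.{u} γ₁.matrix.funs
  -- Avoiding `F` as well as the variables of `m` ensures that the second renaming does not bring
  -- variables of `F` into `m'`.
  obtain ⟨⟨G, Y, m'⟩, hγ₂, hγd, hγf, hγl, hγs⟩ := γ₁.exists_renaming.{u} (m.funs ∪ F)
  replace hαl := hαl hαl₁
  replace hγl := hγl hγl₁
  replace hα₁ : DCDeducible α ⟨F, X, m⟩ := hα₁.tail (.inr (.inr (.inr hα₂)))
  replace hγ₁ : DCDeducible δ.dual ⟨G, Y, m'⟩ := hγ₁.tail (.inr (.inr (.inr hγ₂)))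
  rw [Finset.disjoint_union_right] at hγd
  have hd : Disjoint F m'.funs :=
    (Finset.disjoint_union_right.2 ⟨hαd, hγd.2.symm⟩).mono_right hγf
  have hd' : Disjoint G m.funs := hγd.1
  -- With an empty matrix on either side the overlap condition of Criss-Crossing is vacuous.
  rcases m.eq_empty_or_nonempty with rfl | ⟨Γ₀, hΓ₀⟩
  · exact .of_literal hα₁ hγ₁ hγl hd hd' default default (by simp)
  rcases m'.eq_empty_or_nonempty with rfl | ⟨Δ₀, hΔ₀⟩
  · exact .of_literal hα₁ hγ₁ hγl hd hd' default default (by simp)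
  obtain ⟨s, s', hs⟩ := exists_finite_instances hαl hγl fun I hI =>
    h.not_sat I ⟨hαs₁ I (hαs I hI.1), hγs₁ _ (hγs _ hI.2)⟩
  -- If the empty component were available, selecting it for every instance would avoid all
  -- overlaps.
  have hm : ∅ ∉ m := fun h => by
    obtain ⟨_, -, _, -, A, hA, -⟩ := hs (fun _ => ∅) (fun _ => Δ₀) (fun _ => h) fun _ => hΔ₀
    simp at hA
  have hm' : ∅ ∉ m' := fun h => by
    obtain ⟨_, -, _, -, A, -, hA⟩ := hs (fun _ => Γ₀) (fun _ => ∅) (fun _ => hΓ₀) fun _ => h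
    simp at hA
  obtain ⟨k, T, hT⟩ := Finset.exists_nat_enumeration s
  obtain ⟨k', T', hT'⟩ := Finset.exists_nat_enumeration s'
  obtain ⟨X₁, m₁, θ, hβ, -, hf₁, hθ, hc⟩ :=
    exists_multiplication F X hm hαl k (fun i => (T i).1) fun i => (T i).2
  obtain ⟨Y₁, m₁', θ', hγ, hl, hf₁', hθ', hc'⟩ :=
    exists_multiplication G Y hm' hγl k' (fun i => (T' i).1) fun i => (T' i).2
  refine .of_literal (hα₁.trans hβ) (hγ₁.trans hγ) hl (hd.mono_right hf₁') (hd'.mono_right hf₁)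
    ⟨θ, hθ⟩ ⟨θ', hθ'⟩ fun Γ hΓ Δ hΔ => ?_
  -- A component of the multiplied matrix includes, under `θ`, a component of each required
  -- instance, and so determines a selection; outside `s` the default `Γ₀` is harmless.
  have hsel : ∀ τ : SubstOn X, ∃ Θ ∈ m, τ ∈ s →
      Θ.image (Formula.substVars τ.1) ⊆ Γ.image (Formula.substVars θ) := fun τ => by
    by_cases hτ : τ ∈ s
    · obtain ⟨i, hi, rfl⟩ := hT τ hτ
      obtain ⟨Θ, hΘ, hsub⟩ := hc Γ hΓ i hi
      exact ⟨Θ, hΘ, fun _ => hsub⟩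
    · exact ⟨Γ₀, hΓ₀, fun h => (hτ h).elim⟩
  have hsel' : ∀ τ : SubstOn Y, ∃ Θ ∈ m', τ ∈ s' →
      Θ.image (Formula.substVars τ.1) ⊆ Δ.image (Formula.substVars θ') := fun τ => by
    by_cases hτ : τ ∈ s'
    · obtain ⟨i, hi, rfl⟩ := hT' τ hτ
      obtain ⟨Θ, hΘ, hsub⟩ := hc' Δ hΔ i hi
      exact ⟨Θ, hΘ, fun _ => hsub⟩
    · exact ⟨Δ₀, hΔ₀, fun h => (hτ h).elim⟩
  choose c hcm hcs using hsel
  choose d hdm hds using hsel'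
  obtain ⟨τ, hτ, τ', hτ', A, hA, hA'⟩ := hs c d hcm hdm
  exact ⟨A, hcs τ hτ hA, hds τ' hτ' hA'⟩

end FDEQ

theorem mainTheorem12 :
    -- Herbrand theorem for FDEQ
    (∀ (n m : ℕ) (A : FDEQ.Formula n) (B : FDEQ.Formula m),
      A.QuantifierFree → B.QuantifierFree →
      (FDEQ.FormulaEntails.{u, v} A.allClosure B.exClosure ↔
        FDEQ.FDEEntails.{v}
          (FDEQ.herbrandInstances (A.funs ∪ B.funs) A)
          (FDEQ.herbrandInstances (A.funs ∪ B.funs) B))) ∧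
    -- deductive completeness of FDEQHC
    (∀ (α : FDEQ.Datum) (δ : FDEQ.DualDatum),
      FDEQ.Entails.{u, v} α δ → FDEQ.HCDeducible α δ) :=
  ⟨fun _ _ _ _ hA hB => FDEQ.formulaEntails_allClosure_exClosure_iff hA hB,
    fun _ _ h => h.hcDeducible⟩
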